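/- For a group $G$ let $m_n(G)$ be the number of maximal subgroups of $G$ of index $n$, and let \[ \operatorname{mdeg}(G)=\inf\{\alpha\in\mathbb{R} : m_n(G)\le n^{\alpha}\text{ for all large } n\}\in[-\infty,\infty]. \] Theorem. Let $G$ be a group with a finitely generated abelian normal subgroup $N$ such that $G/N$ is abelian and generated by $\ell_0$ elements $g_1,\dots,g_{\ell_0}$. Let $\ell$ be the torsion-free rank of $G/N$. Let $R=\mathbb{Z}[x_1,\dots,x_{\ell_0}]$, and regard $N$ as an $R$-module by letting $x_i$ act on $N$ as conjugation by $g_i$ (well defined, since $N$ is abelian). Let $I=(x_1-1,\dots,x_{\ell_0}-1)\subseteq R$, let $t$ be the torsion-free rank of the abelian group $N/IN$, and let $d$ be the minimal number of generators of $\mathbb{Q}\otimes_{\mathbb{Z}}N$ as a module over $\mathbb{Q}\otimes_{\mathbb{Z}}R$. Then \[ \operatorname{mdeg}(G)\le\max\{\ell+t-1,\,d\}. \] If moreover $\ell\ge 1$ and $G\cong N\rtimes G/N$ (where $G/N$ acts on $N$ by conjugation), then \[ \operatorname{mdeg}(G)=\max\{\ell+t-1,\,d\}. \] -/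

import Mathlib

open scoped TensorProduct IsMulCommutative

noncomputable section

/-- The number of maximal subgroups of `G` of index `n` (as an extended natural number). -/
def maxSubgroupCount (G : Type*) [Group G] (n : ℕ) : ℕ∞ :=
  {M : Subgroup G | IsCoatom M ∧ M.index = n}.encard

/-- The degree of maximal subgroup growth: the infimum in `[-∞, ∞]` of all real `α` such that the
number of maximal subgroups of index `n` is at most `n ^ α` for all large `n`. -/
def mdeg (G : Type*) [Group G] : EReal :=
  sInf ((fun α : ℝ => (α : EReal)) '' {α : ℝ | ∀ᶠ n : ℕ in Filter.atTop,
    (maxSubgroupCount G n : ENNReal) ≤ (n : ENNReal) ^ α})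

/-- The torsion-free rank of an abelian group: the maximal number of `ℤ`-linearly independent
elements. -/
def torsionFreeRank (A : Type*) [AddCommGroup A] : ℕ := Module.finrank ℤ A

section ConjugationModule

variable {G : Type*} [Group G] (N : Subgroup G) [N.Normal] [IsMulCommutative N]

/-- The conjugation action of `G ⧸ N` on the abelian normal subgroup `N`. -/
def conjAct : G ⧸ N →* MulAut N :=
  QuotientGroup.lift N MulAut.conjNormal (by
    intro a ha
    ext b
    have h : (⟨a, ha⟩ : N) * b = b * ⟨a, ha⟩ := mul_comm' _ _
    have h' : a * (b : G) = b * a := congrArg Subtype.val h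
    simp [MulAut.conjNormal_apply, h'])

/-- The conjugation action of `G ⧸ N` on `N`, written additively, by `ℤ`-linear maps. -/
def conjRep : Representation ℤ (G ⧸ N) (Additive N) where
  toFun q := (MonoidHom.toAdditive (conjAct N q).toMonoidHom).toIntLinearMap
  map_one' := by ext; simp
  map_mul' a b := by ext; simp

variable [IsMulCommutative (G ⧸ N)] {k : ℕ} (g : Fin k → G ⧸ N)

/-- The action of `ℤ[x₁, …, x_k]` on `N`: the variable `x_i` acts as conjugation by `g i`. It
factors through the group ring of `G ⧸ N`. -/
def polyAction : MvPolynomial (Fin k) ℤ →ₐ[ℤ] Module.End ℤ (Additive N) :=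
  (conjRep N).asAlgebraHom.comp
    (MvPolynomial.aeval fun i => MonoidAlgebra.of ℤ (G ⧸ N) (g i))

/-- The group `N`, written additively, as a module over `ℤ[x₁, …, x_k]`. -/
@[nolint unusedArguments]
def PolyModule (_g : Fin k → G ⧸ N) : Type _ := Additive N

instance : AddCommGroup (PolyModule N g) := inferInstanceAs (AddCommGroup (Additive N))

instance : Module (MvPolynomial (Fin k) ℤ) (PolyModule N g) :=
  Module.compHom (Additive N) (polyAction N g).toRingHom

/-- An element of `N` as an element of the polynomial module. -/
def PolyModule.of (n : N) : PolyModule N g := (Additive.ofMul n : Additive N)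

theorem PolyModule.X_smul (i : Fin k) (a : G) (ha : g i = QuotientGroup.mk a) (n : N) :
    (MvPolynomial.X i : MvPolynomial (Fin k) ℤ) • PolyModule.of N g n =
      PolyModule.of N g ⟨a * n * a⁻¹, Subgroup.Normal.conj_mem inferInstance _ n.2 a⟩ := by
  change polyAction N g (MvPolynomial.X i) (Additive.ofMul n : Additive N) = _
  simp only [polyAction, AlgHom.comp_apply, MvPolynomial.aeval_X,
    Representation.asAlgebraHom_of, ha]
  rfl

/-- The ideal `I = (x₁ - 1, …, x_k - 1)` of `ℤ[x₁, …, x_k]`. -/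
def augIdeal (k : ℕ) : Ideal (MvPolynomial (Fin k) ℤ) :=
  Ideal.span (Set.range fun i => MvPolynomial.X i - 1)

/-- The abelian group `N / I N`. -/
abbrev PolyModule.Coinvariants : Type _ :=
  PolyModule N g ⧸ (augIdeal k • (⊤ : Submodule (MvPolynomial (Fin k) ℤ) (PolyModule N g)))

/-- `ℚ ⊗ N`, to be seen as a module over `ℚ ⊗ ℤ[x₁, …, x_k]`. -/
def RatPolyModule : Type _ := ℚ ⊗[ℤ] PolyModule N g

instance : AddCommGroup (RatPolyModule N g) :=
  inferInstanceAs (AddCommGroup (ℚ ⊗[ℤ] PolyModule N g))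

/-- The action of `ℚ ⊗ ℤ[x₁, …, x_k]` on `ℚ ⊗ N`, given by `(a ⊗ r) (b ⊗ n) = a b ⊗ r n`. -/
def ratPolyAction : (ℚ ⊗[ℤ] MvPolynomial (Fin k) ℤ) →ₐ[ℚ]
    Module.End ℚ (ℚ ⊗[ℤ] PolyModule N g) :=
  Algebra.TensorProduct.lift (Algebra.ofId ℚ _)
    ((Module.End.baseChangeHom ℤ ℚ (PolyModule N g)).comp
      (Algebra.lsmul ℤ ℤ (PolyModule N g)))
    (fun a _ => by rw [Algebra.ofId_apply]; exact Algebra.commute_algebraMap_left a _)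

instance : Module (ℚ ⊗[ℤ] MvPolynomial (Fin k) ℤ) (RatPolyModule N g) :=
  Module.compHom (ℚ ⊗[ℤ] PolyModule N g) (ratPolyAction N g).toRingHom

/-- The pure tensor `a ⊗ n` in `ℚ ⊗ N`. -/
def RatPolyModule.tmul (a : ℚ) (n : PolyModule N g) : RatPolyModule N g :=
  (a ⊗ₜ[ℤ] n : ℚ ⊗[ℤ] PolyModule N g)

theorem RatPolyModule.tmul_smul_tmul (a b : ℚ) (r : MvPolynomial (Fin k) ℤ)
    (n : PolyModule N g) :
    (a ⊗ₜ[ℤ] r : ℚ ⊗[ℤ] MvPolynomial (Fin k) ℤ) • RatPolyModule.tmul N g b n =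
      RatPolyModule.tmul N g (a * b) (r • n) := by
  change ratPolyAction N g (a ⊗ₜ[ℤ] r) (b ⊗ₜ[ℤ] n : ℚ ⊗[ℤ] PolyModule N g) =
    ((a * b) ⊗ₜ[ℤ] (r • n) : ℚ ⊗[ℤ] PolyModule N g)
  rw [ratPolyAction, Algebra.TensorProduct.lift_tmul, Algebra.ofId_apply,
    Module.End.mul_apply, Module.algebraMap_end_apply]
  change a • (b ⊗ₜ[ℤ] (r • n) : ℚ ⊗[ℤ] PolyModule N g) = _
  rw [TensorProduct.smul_tmul', smul_eq_mul]

end ConjugationModule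

end

/-!
Let `ℓ`, `t`, `d` be as in the theorem, and view `N` as a module over `R = ℤ[x₁, …, x_k]`. Since
`N` is finitely generated as an abelian group, every element of `G ⧸ N`, including the inverses of
the generators, acts on `N` as a polynomial (`exists_smul_of_eq_conjAct`), so the submodules of `N`
are the subgroups of `N` that are normal in `G`.

*Upper bound.* A maximal subgroup `M` of index `n` is of one of two kinds.

If `M` is normal, it contains the commutator subgroup, so it comes from a maximal subgroup of the
abelianization of `G`. The latter has torsion-free rank at most `ℓ + t`, which leaves
`O(n ^ (ℓ + t - 1))` possibilities (`exists_ncard_normal_mul_le`).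

If `M` is not normal, then `K = M ∩ N` is a maximal submodule of `N` of index `n`, and some `z` in
`G` acts on the simple module `N / K` without nontrivial fixed points. The subgroup `M` meets the
coset `N z`, and it is the centralizer modulo `K` of any `y` in `M ∩ N z`; so for a given `K` there
are at most `n` such `M` (`exists_ncard_not_normal_le`). The number of maximal submodules `K` of
index `n` is `O(n ^ (d - 1))` (`exists_ncard_isCoatom_mul_le`): the number of maximal ideals `m` of
`R` with `|R / m| = n` and `N ≠ m N` is bounded by the Chinese remainder theorem, and for each `m`
one counts surjections `N → R / m`. For large `n` these are determined by their values on `d`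
elements, because some submodule with `d` generators has finite index in `N`.

*Lower bound.* In `N ⋊ G ⧸ N`, maximal subgroups arise as zero sets of surjective crossed
homomorphisms to a finite field (`isCoatom_crossedHomKer`), and linear combinations of independent
crossed homomorphisms give different zero sets (`pow_card_le_maxSubgroupCount`). Homomorphisms to
`ℤ ^ (ℓ + t)`, reduced modulo a prime `p`, give `p ^ (ℓ + t - 1)` maximal subgroups of index `p`.
For the bound by `d`, let `p` be any prime. If `N / m N` had dimension less than `d` for every
maximal ideal `m` containing `p`, then by the Chinese remainder theorem and Nakayama's lemma `N`
would have a submodule of finite index with `d - 1` generators, and these would generate `ℚ ⊗ N`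
(`exists_nsmul_mem_span_of_forall_isMaximal`). Hence there is a surjection `N → (R / m) ^ d` for
some `m` containing `p`; its `d` coordinates, together with one nonzero crossed homomorphism
`G ⧸ N → R / m`, which exists as `ℓ ≥ 1`, give `n ^ d` maximal subgroups of index
`n = |R / m| ≥ p`.
-/

/-! ### Counting in finitely generated modules -/

/-- A `q`-torsion abelian group generated by `r` elements has at most `q ^ r` elements. -/
theorem card_le_pow_of_span_eq_top {P : Type*} [AddCommGroup P] {q r : ℕ} (hq : 0 < q)
    (hP : ∀ x : P, q • x = 0) (v : Fin r → P) (hv : Submodule.span ℤ (Set.range v) = ⊤) :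
    Finite P ∧ Nat.card P ≤ q ^ r := by
  have hsurj : Function.Surjective (fun e : Fin r → Fin q => ∑ i, (e i : ℕ) • v i) := by
    intro x
    have hx : x ∈ Submodule.span ℤ (Set.range v) := hv ▸ Submodule.mem_top
    obtain ⟨a, rfl⟩ := (Submodule.mem_span_range_iff_exists_fun ℤ).1 hx
    have hq' : (0 : ℤ) < q := by exact_mod_cast hq
    have h0 : ∀ i, 0 ≤ a i % q := fun i => Int.emod_nonneg _ hq'.ne'
    have hlt : ∀ i, (a i % q).toNat < q := fun i => by
      have := Int.emod_lt_of_pos (a i) hq'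
      have := h0 i
      omega
    refine ⟨fun i => ⟨(a i % q).toNat, hlt i⟩, Finset.sum_congr rfl fun i _ => ?_⟩
    change (a i % q).toNat • v i = a i • v i
    rw [← natCast_zsmul, Int.toNat_of_nonneg (h0 i)]
    conv_rhs => rw [← Int.emod_add_mul_ediv (a i) q, add_smul, mul_smul, natCast_zsmul, hP,
      add_zero]
  refine ⟨Finite.of_surjective _ hsurj, (Nat.card_le_card_of_surjective _ hsurj).trans ?_⟩
  simp

section CommRing

variable {R N : Type*} [CommRing R] [AddCommGroup N] [Module R N]

/-- The Chinese remainder theorem for modules, for finitely many maximal ideals. -/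
theorem exists_forall_sub_mem_smul_top (T : Finset (Ideal R)) (hT : ∀ m ∈ T, m.IsMaximal)
    (y : Ideal R → N) : ∃ x : N, ∀ m ∈ T, x - y m ∈ m • (⊤ : Submodule R N) := by
  classical
  have hco : Pairwise fun a b : T => IsCoprime (a : Ideal R) b := fun a b hab =>
    haveI := hT _ a.2
    haveI := hT _ b.2
    Ideal.isCoprime_of_isMaximal fun h => hab (Subtype.ext h)
  have key : ∀ m : T, ∃ a : R, a - 1 ∈ (m : Ideal R) ∧ ∀ m' : T, m' ≠ m → a ∈ (m' : Ideal R) := by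
    intro m
    obtain ⟨a, ha⟩ := Ideal.exists_forall_sub_mem_ideal (I := fun m : T => (m : Ideal R)) hco
      (fun m' => if m' = m then 1 else 0)
    exact ⟨a, by simpa using ha m, fun m' hm' => by simpa [hm'] using ha m'⟩
  choose a ha1 ha0 using key
  refine ⟨∑ m : T, a m • y m, fun m hm => ?_⟩
  rw [← Finset.add_sum_erase _ _ (Finset.mem_univ (⟨m, hm⟩ : T)), add_sub_right_comm]
  refine add_mem ?_ (sum_mem fun m' hm' => ?_)
  · have := Submodule.smul_mem_smul (ha1 ⟨m, hm⟩) (Submodule.mem_top (R := R) (x := y m))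
    rwa [sub_smul, one_smul] at this
  · exact Submodule.smul_mem_smul (ha0 m' ⟨m, hm⟩ (Finset.ne_of_mem_erase hm').symm)
      Submodule.mem_top

/-- If `N` is generated by `r` elements as an abelian group, then there are few maximal ideals `m`
which contain a given integer `q` and have `N / m N` large: the product of the groups `N / m N`
is a quotient of `N / q N`. -/
theorem pow_card_le_of_le_card_quotient {q r b : ℕ} (hq : 0 < q) (v : Fin r → N)
    (hv : Submodule.span ℤ (Set.range v) = ⊤) (T : Finset (Ideal R))
    (hT : ∀ m ∈ T, m.IsMaximal) (hqT : ∀ m ∈ T, (q : R) ∈ m)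
    (hb : ∀ m ∈ T, b ≤ Nat.card (N ⧸ m • (⊤ : Submodule R N))) :
    b ^ T.card ≤ q ^ r := by
  classical
  let P := ∀ m : T, N ⧸ (m : Ideal R) • (⊤ : Submodule R N)
  let F : N →ₗ[ℤ] P :=
    (LinearMap.pi fun m : T => ((m : Ideal R) • (⊤ : Submodule R N)).mkQ).restrictScalars ℤ
  have hF : Function.Surjective F := by
    intro y
    choose z hz using fun m : T => Submodule.mkQ_surjective _ (y m)
    obtain ⟨x, hx⟩ := exists_forall_sub_mem_smul_top T hT
      (fun m => if h : m ∈ T then z ⟨m, h⟩ else 0)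
    refine ⟨x, funext fun m => ?_⟩
    have := hx m m.2
    simp only [m.2, dif_pos] at this
    rw [← hz m]
    exact (Submodule.Quotient.eq _).2 this
  have hP : ∀ x : P, q • x = 0 := by
    intro x
    obtain ⟨x, rfl⟩ := hF x
    rw [← map_nsmul]
    funext m
    refine (Submodule.Quotient.mk_eq_zero _).2 ?_
    rw [← Nat.cast_smul_eq_nsmul R]
    exact Submodule.smul_mem_smul (hqT m m.2) Submodule.mem_top
  have hgen : Submodule.span ℤ (Set.range (F ∘ v)) = ⊤ := by
    rw [Set.range_comp, ← Submodule.map_span, hv, Submodule.map_top,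
      LinearMap.range_eq_top.2 hF]
  obtain ⟨hfin, hcard⟩ := card_le_pow_of_span_eq_top hq hP (F ∘ v) hgen
  refine le_trans ?_ hcard
  rw [Nat.card_pi, ← Fintype.card_coe, ← Finset.card_univ, ← Finset.prod_const]
  exact Finset.prod_le_prod' fun m _ => hb m m.2

/-- The maximal submodules `K` of `N` with `N / K ≅ R / m` are the kernels of the surjections
`N → R / m`, each of which arises from `|R / m| - 1` such surjections. -/
theorem ncard_submodule_quotient_equiv_mul_le (m : Ideal R) [m.IsMaximal] [Finite (R ⧸ m)] {d : ℕ}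
    (u : Fin d → N) {c : ℕ} (hc : (c : R) ∉ m)
    (hu : ∀ x : N, c • x ∈ Submodule.span R (Set.range u)) :
    {K : Submodule R N | Nonempty ((N ⧸ K) ≃ₗ[R] (R ⧸ m))}.Finite ∧
    {K : Submodule R N | Nonempty ((N ⧸ K) ≃ₗ[R] (R ⧸ m))}.ncard * (Nat.card (R ⧸ m) - 1) ≤
      Nat.card (R ⧸ m) ^ d := by
  classical
  let _ : Field (R ⧸ m) := Ideal.Quotient.field m
  set S := {K : Submodule R N | Nonempty ((N ⧸ K) ≃ₗ[R] (R ⧸ m))} with hS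
  let f : S → N →ₗ[R] (R ⧸ m) := fun K => (Classical.choice K.2).toLinearMap ∘ₗ K.1.mkQ
  have hf : ∀ K : S, Function.Surjective (f K) := fun K =>
    (Classical.choice K.2).surjective.comp (Submodule.mkQ_surjective _)
  have hker : ∀ K : S, LinearMap.ker (f K) = K := fun K => by
    simp only [f, LinearEquiv.ker_comp, Submodule.ker_mkQ]
  let Φ : S × (R ⧸ m)ˣ → (Fin d → R ⧸ m) := fun p i => p.2 * f p.1 (u i)
  have hΦ : Function.Injective Φ := by
    rintro ⟨K, a⟩ ⟨K', a'⟩ h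
    have hlin : ∀ x : N, (a : R ⧸ m) * f K x = a' * f K' x := by
      obtain ⟨s, hs⟩ := Ideal.Quotient.mk_surjective (a : R ⧸ m)
      obtain ⟨s', hs'⟩ := Ideal.Quotient.mk_surjective (a' : R ⧸ m)
      have hsm : ∀ (s : R) (z : R ⧸ m), Ideal.Quotient.mk m s * z = s • z := fun s z => by
        rw [Algebra.smul_def]; rfl
      have heq : ∀ z ∈ Submodule.span R (Set.range u), (s • f K) z = (s' • f K') z := by
        refine LinearMap.eqOn_span (f := s • f K) (g := s' • f K') ?_
        rintro _ ⟨i, rfl⟩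
        have := congrFun h i
        simpa only [Φ, LinearMap.smul_apply, ← hsm, hs, hs'] using this
      intro x
      have hx := heq _ (hu x)
      rw [← Nat.cast_smul_eq_nsmul R, map_smul, map_smul, ← hsm, ← hsm] at hx
      have hc' : Ideal.Quotient.mk m (c : R) ≠ 0 := fun h0 =>
        hc (Ideal.Quotient.eq_zero_iff_mem.1 h0)
      have := mul_left_cancel₀ hc' hx
      simpa only [LinearMap.smul_apply, ← hsm, hs, hs'] using this
    have hKK : K = K' := by
      apply Subtype.ext
      rw [← hker K, ← hker K']
      ext x
      have := hlin x
      rw [LinearMap.mem_ker, LinearMap.mem_ker]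
      constructor
      · intro h0
        rw [h0, mul_zero] at this
        exact (mul_eq_zero.1 this.symm).resolve_left a'.ne_zero
      · intro h0
        rw [h0, mul_zero] at this
        exact (mul_eq_zero.1 this).resolve_left a.ne_zero
    subst hKK
    obtain ⟨x, hx⟩ := hf K 1
    have := hlin x
    rw [hx, mul_one, mul_one] at this
    exact Prod.ext rfl (Units.ext this)
  have hfin : Finite (S × (R ⧸ m)ˣ) := Finite.of_injective Φ hΦ
  have hSfin : Finite S := Finite.of_surjective (Prod.fst : S × (R ⧸ m)ˣ → S) Prod.fst_surjective
  refine ⟨hSfin, ?_⟩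
  have := Nat.card_le_card_of_injective Φ hΦ
  rw [Nat.card_prod, Nat.card_units, Nat.card_fun, Nat.card_fin] at this
  exact this

theorem card_quotient_le_pow {q r : ℕ} (hq : 0 < q) (v : Fin r → N)
    (hv : Submodule.span ℤ (Set.range v) = ⊤) (K : Submodule R N)
    (hK : ∀ x : N, q • x ∈ K) : Finite (N ⧸ K) ∧ Nat.card (N ⧸ K) ≤ q ^ r := by
  refine card_le_pow_of_span_eq_top hq (fun x => ?_) (K.mkQ.restrictScalars ℤ ∘ v) ?_
  · obtain ⟨x, rfl⟩ := K.mkQ_surjective x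
    rw [← map_nsmul]
    exact (Submodule.Quotient.mk_eq_zero _).2 (hK x)
  · rw [Set.range_comp, ← Submodule.map_span, hv, Submodule.map_top]
    exact LinearMap.range_eq_top.2 K.mkQ_surjective

theorem nsmul_mem_smul_top {q : ℕ} {m : Ideal R} (hq : (q : R) ∈ m) (x : N) :
    q • x ∈ m • (⊤ : Submodule R N) := by
  rw [← Nat.cast_smul_eq_nsmul R]
  exact Submodule.smul_mem_smul hq Submodule.mem_top

theorem smul_top_le_of_quotient_equiv {m : Ideal R} {K : Submodule R N}
    (e : (N ⧸ K) ≃ₗ[R] (R ⧸ m)) : m • (⊤ : Submodule R N) ≤ K := by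
  rw [Submodule.smul_le]
  intro a ha x _
  rw [← Submodule.Quotient.mk_eq_zero, Submodule.Quotient.mk_smul]
  apply e.injective
  rw [map_smul, map_zero]
  obtain ⟨y, hy⟩ := Ideal.Quotient.mk_surjective (e (Submodule.Quotient.mk x))
  rw [← hy]
  exact Ideal.Quotient.eq_zero_iff_mem.2 (Ideal.mul_mem_right _ _ ha)

/-- If a submodule generated by `d` elements has finite index in `N`, then `N` has at most
`O(n ^ (d - 1))` maximal submodules of large index `n`. -/
theorem exists_ncard_isCoatom_mul_le [Module.Finite ℤ N] {d : ℕ}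
    (u : Fin d → N) {c : ℕ} (hc : 0 < c)
    (hu : ∀ x : N, c • x ∈ Submodule.span R (Set.range u)) :
    ∃ C n₀ : ℕ, ∀ n ≥ n₀,
      {K : Submodule R N | IsCoatom K ∧ Nat.card (N ⧸ K) = n}.Finite ∧
      {K : Submodule R N | IsCoatom K ∧ Nat.card (N ⧸ K) = n}.ncard * n ≤ C * n ^ d := by
  classical
  obtain ⟨r, v, hv⟩ := Module.Finite.exists_fin (R := ℤ) (M := N)
  refine ⟨2 * r, c ^ r + 2, fun n hn => ?_⟩
  have hn2 : 2 ≤ n := by omega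
  have hn0 : 0 < n := by omega
  set S := {K : Submodule R N | IsCoatom K ∧ Nat.card (N ⧸ K) = n} with hS
  let T : Set (Ideal R) := {m | m.IsMaximal ∧ Nat.card (R ⧸ m) = n ∧ (c : R) ∉ m ∧
    n ≤ Nat.card (N ⧸ m • (⊤ : Submodule R N))}
  have hmem : ∀ m : Ideal R, Nat.card (R ⧸ m) = n → (n : R) ∈ m := by
    intro m hm
    rw [← Ideal.Quotient.eq_zero_iff_mem, map_natCast, ← nsmul_one, ← hm]
    exact card_nsmul_eq_zero'
  have hTcard : ∀ T₀ : Finset (Ideal R), ↑T₀ ⊆ T → T₀.card ≤ r := by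
    intro T₀ hT₀
    refine (Nat.pow_le_pow_iff_right (a := n) (by omega)).1 ?_
    exact pow_card_le_of_le_card_quotient hn0 v hv T₀ (fun m hm => (hT₀ hm).1)
      (fun m hm => hmem m (hT₀ hm).2.1) (fun m hm => (hT₀ hm).2.2.2)
  have hTfin : T.Finite := by
    by_contra hinf
    obtain ⟨T₀, hT₀, hcard⟩ := Set.Infinite.exists_subset_card_eq hinf (r + 1)
    have := hTcard T₀ hT₀
    omega
  have hsub : S ⊆ ⋃ m ∈ hTfin.toFinset, {K | Nonempty ((N ⧸ K) ≃ₗ[R] (R ⧸ m))} := by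
    rintro K ⟨hK, hcardK⟩
    have hsimple : IsSimpleModule R (N ⧸ K) := isSimpleModule_iff_isCoatom.2 hK
    obtain ⟨m, hm, ⟨e⟩⟩ := isSimpleModule_iff_quot_maximal.1 hsimple
    have hcm : Nat.card (R ⧸ m) = n := by rw [← hcardK, Nat.card_congr e.toEquiv]
    have hle : m • (⊤ : Submodule R N) ≤ K := smul_top_le_of_quotient_equiv e
    have hfin := (card_quotient_le_pow hn0 v hv (m • (⊤ : Submodule R N))
      (nsmul_mem_smul_top (hmem m hcm))).1
    have hcc : (c : R) ∉ m := by
      intro h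
      have := (card_quotient_le_pow hc v hv K (fun x => hle (nsmul_mem_smul_top h x))).2
      omega
    refine Set.mem_iUnion₂.2 ⟨m, hTfin.mem_toFinset.2 ⟨hm, hcm, hcc, ?_⟩, ⟨e⟩⟩
    rw [← hcardK]
    exact Nat.card_le_card_of_surjective (Submodule.factor hle) (Submodule.factor_surjective hle)
  have hpiece : ∀ m ∈ hTfin.toFinset, {K : Submodule R N | Nonempty ((N ⧸ K) ≃ₗ[R] (R ⧸ m))}.Finite
      ∧ {K : Submodule R N | Nonempty ((N ⧸ K) ≃ₗ[R] (R ⧸ m))}.ncard * (n - 1) ≤ n ^ d := by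
    intro m hm
    obtain ⟨hmax, hcard, hcc, -⟩ := hTfin.mem_toFinset.1 hm
    have : Finite (R ⧸ m) := Nat.finite_of_card_ne_zero (by omega)
    simpa only [hcard] using ncard_submodule_quotient_equiv_mul_le m u hcc hu
  have hUfin : (⋃ m ∈ hTfin.toFinset,
      {K : Submodule R N | Nonempty ((N ⧸ K) ≃ₗ[R] (R ⧸ m))}).Finite :=
    Set.Finite.biUnion hTfin.toFinset.finite_toSet fun m hm => (hpiece m hm).1
  refine ⟨hUfin.subset hsub, ?_⟩
  have h1 : S.ncard * (n - 1) ≤ r * n ^ d := calc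
    S.ncard * (n - 1) ≤ (∑ m ∈ hTfin.toFinset,
        {K : Submodule R N | Nonempty ((N ⧸ K) ≃ₗ[R] (R ⧸ m))}.ncard) * (n - 1) :=
      Nat.mul_le_mul_right _ ((Set.ncard_le_ncard hsub hUfin).trans
        (Finset.set_ncard_biUnion_le _ _))
    _ ≤ ∑ m ∈ hTfin.toFinset, n ^ d := by
      rw [Finset.sum_mul]
      exact Finset.sum_le_sum fun m hm => (hpiece m hm).2
    _ ≤ r * n ^ d := by
      rw [Finset.sum_const, smul_eq_mul]
      exact Nat.mul_le_mul_right _ (hTcard _ (by simp))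
  calc S.ncard * n ≤ S.ncard * (2 * (n - 1)) := Nat.mul_le_mul_left _ (by omega)
    _ = 2 * (S.ncard * (n - 1)) := by ring
    _ ≤ 2 * (r * n ^ d) := Nat.mul_le_mul_left _ h1
    _ = 2 * r * n ^ d := by ring

/-- If `N / m N` is generated by `e` elements for every maximal ideal `m` containing `p`, then by
the Chinese remainder theorem and Nakayama's lemma `N / p N` is generated by `e` elements, and
the submodule generated by lifts of these has finite index in `N`. -/
theorem exists_nsmul_mem_span_of_forall_isMaximal [Module.Finite ℤ N] {e p : ℕ} (hp : 2 ≤ p)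
    (h : ∀ m : Ideal R, m.IsMaximal → (p : R) ∈ m → ∃ y : Fin e → N,
      Submodule.span R (Set.range y) ⊔ m • (⊤ : Submodule R N) = ⊤) :
    ∃ (u : Fin e → N) (c : ℕ), 0 < c ∧ ∀ x : N, c • x ∈ Submodule.span R (Set.range u) := by
  classical
  obtain ⟨r, v, hv⟩ := Module.Finite.exists_fin (R := ℤ) (M := N)
  have hp0 : 0 < p := by omega
  let T : Set (Ideal R) := {m | m.IsMaximal ∧ (p : R) ∈ m ∧ m • (⊤ : Submodule R N) ≠ ⊤}
  have hTfin : T.Finite := by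
    by_contra hinf
    obtain ⟨T₀, hT₀, hcard⟩ := Set.Infinite.exists_subset_card_eq hinf (p ^ r)
    have := pow_card_le_of_le_card_quotient (b := 2) hp0 v hv T₀ (fun m hm => (hT₀ hm).1)
      (fun m hm => (hT₀ hm).2.1) fun m hm => by
        have := (card_quotient_le_pow hp0 v hv (m • (⊤ : Submodule R N))
          (nsmul_mem_smul_top (hT₀ hm).2.1)).1
        have : Nontrivial (N ⧸ m • (⊤ : Submodule R N)) :=
          Submodule.Quotient.nontrivial_iff.2 (hT₀ hm).2.2
        exact Finite.one_lt_card
    rw [hcard] at this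
    exact absurd this (not_le.2 Nat.lt_two_pow_self)
  choose! y hy using h
  have hT : ∀ m ∈ hTfin.toFinset, m.IsMaximal := fun m hm => (hTfin.mem_toFinset.1 hm).1
  choose u hu using fun i : Fin e => exists_forall_sub_mem_smul_top hTfin.toFinset hT
    (fun m => y m i)
  set U := Submodule.span R (Set.range u) with hU
  have hUm : ∀ m : Ideal R, m.IsMaximal → (p : R) ∈ m → U ⊔ m • (⊤ : Submodule R N) = ⊤ := by
    intro m hm hpm
    by_cases htop : m • (⊤ : Submodule R N) = ⊤
    · rw [htop, sup_top_eq]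
    · refine top_le_iff.1 ((hy m hm hpm).ge.trans (sup_le (Submodule.span_le.2 ?_) le_sup_right))
      rintro _ ⟨i, rfl⟩
      have h1 := hu i m (hTfin.mem_toFinset.2 ⟨hm, hpm, htop⟩)
      have h2 : u i ∈ U := Submodule.subset_span ⟨i, rfl⟩
      have := sub_mem (Submodule.mem_sup_left (T := m • (⊤ : Submodule R N)) h2)
        (Submodule.mem_sup_right (S := U) h1)
      rwa [sub_sub_cancel] at this
  have hfinR : Module.Finite R N := by
    refine ⟨⟨Finset.univ.image v, ?_⟩⟩
    rw [eq_top_iff]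
    intro x _
    have hx : x ∈ Submodule.span ℤ (Set.range v) := hv ▸ Submodule.mem_top
    obtain ⟨a, rfl⟩ := (Submodule.mem_span_range_iff_exists_fun ℤ).1 hx
    exact sum_mem fun i _ => zsmul_mem (Submodule.subset_span (by simp)) _
  have hUp : U ⊔ (Ideal.span {(p : R)}) • (⊤ : Submodule R N) = ⊤ := by
    by_contra hne
    obtain ⟨P, hP, hle⟩ := (eq_top_or_exists_le_coatom _).resolve_left hne
    obtain ⟨m, hm, ⟨e⟩⟩ := isSimpleModule_iff_quot_maximal.1 (isSimpleModule_iff_isCoatom.2 hP)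
    have hpm : (p : R) ∈ m := by
      obtain ⟨x, hx⟩ := P.mkQ_surjective (e.symm 1)
      have h0 : p • x ∈ P := hle (Submodule.mem_sup_right
        (nsmul_mem_smul_top (Ideal.mem_span_singleton_self _) x))
      rw [← Submodule.Quotient.mk_eq_zero] at h0
      have h1 : e (p • e.symm 1) = 0 := by
        rw [← hx]
        exact (congrArg e h0).trans (map_zero e)
      rw [map_nsmul, e.apply_symm_apply, nsmul_one] at h1
      rw [← Ideal.Quotient.eq_zero_iff_mem, map_natCast, h1]
    exact hP.1 (top_le_iff.1 ((hUm m hm hpm).ge.trans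
      (sup_le (le_sup_left.trans hle) (smul_top_le_of_quotient_equiv e))))
  -- Over `ℤ`, the finitely generated module `N / U` satisfies `p (N / U) = N / U`.
  obtain ⟨s, hs, hs0⟩ := Submodule.exists_sub_one_mem_and_smul_eq_zero_of_fg_of_le_smul
    (Ideal.span {(p : ℤ)}) (⊤ : Submodule ℤ (N ⧸ U)) Module.Finite.fg_top (by
      intro z _
      obtain ⟨x, rfl⟩ := U.mkQ_surjective z
      obtain ⟨a, ha, b, hb, rfl⟩ := Submodule.mem_sup.1 (hUp ▸ Submodule.mem_top : x ∈ _)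
      rw [Submodule.ideal_span_singleton_smul] at hb
      obtain ⟨b, -, rfl⟩ := hb
      have ha0 : U.mkQ a = 0 := (Submodule.Quotient.mk_eq_zero U).2 ha
      have : U.mkQ (a + (p : R) • b) = (p : ℤ) • U.mkQ b := by
        rw [map_add, ha0, zero_add, Nat.cast_smul_eq_nsmul,
          map_nsmul, natCast_zsmul]
      change U.mkQ (a + (p : R) • b) ∈ _
      rw [this]
      exact Submodule.smul_mem_smul (Ideal.mem_span_singleton_self _) Submodule.mem_top)
  refine ⟨u, s.natAbs, ?_, fun x => ?_⟩
  · rw [Int.natAbs_pos]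
    rintro rfl
    rw [Ideal.mem_span_singleton] at hs
    have := Int.le_of_dvd one_pos (by simpa using hs)
    omega
  · have h1 : s • x ∈ U := by
      rw [← Submodule.Quotient.mk_eq_zero]
      exact hs0 (Submodule.Quotient.mk x) Submodule.mem_top
    rcases Int.natAbs_eq s with h | h
    · rwa [h, natCast_zsmul] at h1
    · rw [h, neg_smul, natCast_zsmul] at h1
      exact neg_mem_iff.1 h1

/-- If no submodule generated by `e` elements has finite index in `N`, then for every `p ≥ 2` some
quotient `N / m N` with `m` a maximal ideal containing `p` has dimension more than `e`. -/
theorem exists_surjective_to_quotient_pow [Module.Finite ℤ N] {e p : ℕ} (hp : 2 ≤ p)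
    (h : ¬ ∃ (u : Fin e → N) (c : ℕ), 0 < c ∧
      ∀ x : N, c • x ∈ Submodule.span R (Set.range u)) :
    ∃ m : Ideal R, m.IsMaximal ∧ (p : R) ∈ m ∧
      ∃ φ : N →ₗ[R] (Fin (e + 1) → R ⧸ m), Function.Surjective φ := by
  obtain ⟨m, hm, hpm, hy⟩ : ∃ m : Ideal R, m.IsMaximal ∧ (p : R) ∈ m ∧ ∀ y : Fin e → N,
      Submodule.span R (Set.range y) ⊔ m • (⊤ : Submodule R N) ≠ ⊤ := by
    by_contra! hcon
    exact h (exists_nsmul_mem_span_of_forall_isMaximal hp hcon)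
  refine ⟨m, hm, hpm, ?_⟩
  let _ : Field (R ⧸ m) := Ideal.Quotient.field m
  let V := N ⧸ m • (⊤ : Submodule R N)
  obtain ⟨r, v, hv⟩ := Module.Finite.exists_fin (R := ℤ) (M := N)
  have hfin : Finite V := (card_quotient_le_pow (by omega) v hv (m • (⊤ : Submodule R N))
    (nsmul_mem_smul_top hpm)).1
  let b := Module.finBasis (R ⧸ m) V
  have hle : e + 1 ≤ Module.finrank (R ⧸ m) V := by
    by_contra! hlt
    choose z hz using fun i => Submodule.mkQ_surjective (m • (⊤ : Submodule R N)) (b i)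
    refine hy (fun i => if h : (i : ℕ) < Module.finrank (R ⧸ m) V then z ⟨i, h⟩ else 0) ?_
    rw [eq_top_iff]
    intro x _
    choose a ha using fun i => Ideal.Quotient.mk_surjective (b.repr (Submodule.Quotient.mk x) i)
    have hx : x - ∑ i, a i • z i ∈ m • (⊤ : Submodule R N) := by
      rw [← Submodule.Quotient.mk_eq_zero, Submodule.Quotient.mk_sub, sub_eq_zero]
      conv_lhs => rw [← b.sum_repr (Submodule.Quotient.mk x)]
      rw [← Submodule.mkQ_apply (p := m • (⊤ : Submodule R N)) (∑ i, a i • z i), map_sum]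
      refine Finset.sum_congr rfl fun i _ => ?_
      rw [← ha, ← hz, map_smul]
      rfl
    rw [← add_sub_cancel (∑ i, a i • z i) x]
    refine add_mem (Submodule.mem_sup_left (sum_mem fun i _ => Submodule.smul_mem _ _
      (Submodule.subset_span ⟨⟨i, by omega⟩, ?_⟩))) (Submodule.mem_sup_right hx)
    simp
  let π : V →ₗ[R] (Fin (e + 1) → R ⧸ m) :=
    { toFun := fun x i => b.repr x (Fin.castLE hle i)
      map_add' := fun x y => by ext i; simp
      map_smul' := fun s x => by
        ext i
        have : s • x = Ideal.Quotient.mk m s • x := by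
          obtain ⟨x, rfl⟩ := Submodule.mkQ_surjective _ x
          rfl
        rw [this, map_smul, Finsupp.smul_apply, RingHom.id_apply, Pi.smul_apply, smul_eq_mul,
          Algebra.smul_def]
        rfl }
  suffices hπ : Function.Surjective π from
    ⟨π ∘ₗ (m • (⊤ : Submodule R N)).mkQ, hπ.comp (Submodule.mkQ_surjective _)⟩
  intro y
  refine ⟨∑ i, y i • b (Fin.castLE hle i), ?_⟩
  ext i
  change b.repr (∑ i, y i • b (Fin.castLE hle i)) (Fin.castLE hle i) = y i
  rw [map_sum, Finsupp.finsetSum_apply, Finset.sum_eq_single i]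
  · simp
  · intro j _ hj
    simp [hj]
  · simp

end CommRing

/-! ### Ranks as numbers of generators up to finite index -/

/-- If every element of a finitely generated abelian group has a positive multiple in `K`, then
`K` has finite exponent in the whole group. -/
theorem exists_forall_nsmul_mem {A : Type*} [AddCommGroup A] [Module.Finite ℤ A]
    (K : AddSubgroup A) (h : ∀ x : A, ∃ c : ℕ, 0 < c ∧ c • x ∈ K) :
    ∃ c : ℕ, 0 < c ∧ ∀ x : A, c • x ∈ K := by
  classical
  obtain ⟨r, v, hv⟩ := Module.Finite.exists_fin (R := ℤ) (M := A)
  choose c hc hcK using h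
  refine ⟨∏ i, c (v i), Finset.prod_pos fun i _ => hc _, fun x => ?_⟩
  have hx : x ∈ Submodule.span ℤ (Set.range v) := hv ▸ Submodule.mem_top
  obtain ⟨a, rfl⟩ := (Submodule.mem_span_range_iff_exists_fun ℤ).1 hx
  rw [Finset.smul_sum]
  refine sum_mem fun i _ => ?_
  rw [smul_comm]
  refine zsmul_mem ?_ _
  rw [← Finset.prod_erase_mul _ _ (Finset.mem_univ i), mul_smul]
  exact nsmul_mem (hcK _) _

/-- A finitely generated abelian group of torsion-free rank `s` maps onto `ℤ ^ s`. -/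
theorem exists_surjective_to_int_pow {A : Type*} [AddCommGroup A] [Module.Finite ℤ A] {s : ℕ}
    (hs : Module.finrank ℤ A = s) :
    ∃ f : A →ₗ[ℤ] (Fin s → ℤ), Function.Surjective f ∧ LinearMap.ker f = Submodule.torsion ℤ A := by
  have h : Module.finrank ℤ (A ⧸ Submodule.torsion ℤ A) = s :=
    (finrank_quotient_eq_of_le_torsion le_rfl).trans hs
  let b := (Module.finBasis ℤ (A ⧸ Submodule.torsion ℤ A)).reindex (finCongr h)
  refine ⟨b.equivFun.toLinearMap ∘ₗ (Submodule.torsion ℤ A).mkQ,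
    b.equivFun.surjective.comp (Submodule.mkQ_surjective _), ?_⟩
  rw [LinearEquiv.ker_comp, Submodule.ker_mkQ]

theorem exists_nsmul_mem_span_finrank {A : Type*} [AddCommGroup A] [Module.Finite ℤ A] :
    ∃ (u : Fin (Module.finrank ℤ A) → A) (c : ℕ), 0 < c ∧
      ∀ x : A, c • x ∈ Submodule.span ℤ (Set.range u) := by
  obtain ⟨f, hf, hker⟩ := exists_surjective_to_int_pow (A := A) rfl
  choose u hu using fun i => hf (Pi.single i 1)
  refine ⟨u, exists_forall_nsmul_mem (Submodule.span ℤ (Set.range u)).toAddSubgroup fun x => ?_⟩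
  have hx : x - ∑ i, f x i • u i ∈ Submodule.torsion ℤ A := by
    rw [← hker, LinearMap.mem_ker, map_sub, map_sum, sub_eq_zero]
    simp only [map_smul, hu]
    exact pi_eq_sum_univ' (f x)
  obtain ⟨⟨a, ha⟩, ha0⟩ := hx
  have ha' : a ≠ 0 := nonZeroDivisors.ne_zero ha
  refine ⟨a.natAbs, Int.natAbs_pos.2 ha', ?_⟩
  have h0 : a • (x - ∑ i, f x i • u i) = 0 := ha0
  have hax : a • x ∈ Submodule.span ℤ (Set.range u) := by
    rw [smul_sub, sub_eq_zero] at h0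
    rw [h0]
    exact Submodule.smul_mem _ _ (sum_mem fun i _ => Submodule.smul_mem _ _
      (Submodule.subset_span ⟨i, rfl⟩))
  change a.natAbs • x ∈ Submodule.span ℤ (Set.range u)
  rcases Int.natAbs_eq a with h | h
  · rwa [h, natCast_zsmul] at hax
  · rw [h, neg_smul, natCast_zsmul] at hax
    exact neg_mem_iff.1 hax

section ConjugationModule

variable {G : Type*} [Group G] (N : Subgroup G) [IsMulCommutative N] {k : ℕ} (g : Fin k → G ⧸ N)

theorem PolyModule.module_finite_int [Group.FG N] : Module.Finite ℤ (PolyModule N g) :=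
  haveI : Module.Finite ℤ (Additive N) := Module.Finite.iff_addGroup_fg.2 inferInstance
  inferInstanceAs (Module.Finite ℤ (Additive N))

theorem RatPolyModule.induction {P : RatPolyModule N g → Prop} (h0 : P 0)
    (htmul : ∀ q n, P (RatPolyModule.tmul N g q n)) (hadd : ∀ x y, P x → P y → P (x + y))
    (x : RatPolyModule N g) : P x :=
  TensorProduct.induction_on (motive := fun y : ℚ ⊗[ℤ] PolyModule N g => P y) x h0 htmul hadd

theorem RatPolyModule.tmul_add (q : ℚ) (x y : PolyModule N g) :
    RatPolyModule.tmul N g q (x + y) = RatPolyModule.tmul N g q x + RatPolyModule.tmul N g q y :=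
  TensorProduct.tmul_add _ _ _

theorem RatPolyModule.tmul_nsmul (q : ℚ) (c : ℕ) (x : PolyModule N g) :
    RatPolyModule.tmul N g q (c • x) = RatPolyModule.tmul N g (q * c) x := by
  change (q ⊗ₜ[ℤ] (c • x) : ℚ ⊗[ℤ] PolyModule N g) = (q * c) ⊗ₜ[ℤ] x
  rw [← natCast_zsmul, TensorProduct.tmul_smul, TensorProduct.smul_tmul', zsmul_eq_mul, mul_comm,
    Int.cast_natCast]

theorem RatPolyModule.nsmul_tmul (q : ℚ) (c : ℕ) (x : PolyModule N g) :
    c • RatPolyModule.tmul N g q x = RatPolyModule.tmul N g (q * c) x := by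
  change c • (q ⊗ₜ[ℤ] x : ℚ ⊗[ℤ] PolyModule N g) = (q * c) ⊗ₜ[ℤ] x
  rw [← natCast_zsmul, TensorProduct.smul_tmul', zsmul_eq_mul, mul_comm, Int.cast_natCast]

theorem RatPolyModule.tmul_one_zsmul (a : ℤ) (x : PolyModule N g) :
    RatPolyModule.tmul N g 1 (a • x) = RatPolyModule.tmul N g a x := by
  change (1 ⊗ₜ[ℤ] (a • x) : ℚ ⊗[ℤ] PolyModule N g) = (a : ℚ) ⊗ₜ[ℤ] x
  rw [TensorProduct.tmul_smul, TensorProduct.smul_tmul', zsmul_eq_mul, mul_one]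

variable [N.Normal] [IsMulCommutative (G ⧸ N)]

theorem PolyModule.module_finite_int_quotient [Group.FG N]
    (K : Submodule (MvPolynomial (Fin k) ℤ) (PolyModule N g)) :
    Module.Finite ℤ (PolyModule N g ⧸ K) :=
  haveI := PolyModule.module_finite_int N g
  Module.Finite.of_surjective (K.mkQ.restrictScalars ℤ) K.mkQ_surjective

theorem RatPolyModule.span_tmul_eq_top {e : ℕ} (u : Fin e → PolyModule N g) {c : ℕ} (hc : 0 < c)
    (hu : ∀ x, c • x ∈ Submodule.span (MvPolynomial (Fin k) ℤ) (Set.range u)) :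
    Submodule.span (ℚ ⊗[ℤ] MvPolynomial (Fin k) ℤ)
      (Set.range fun i => RatPolyModule.tmul N g 1 (u i)) = ⊤ := by
  rw [eq_top_iff]
  set U := Submodule.span (ℚ ⊗[ℤ] MvPolynomial (Fin k) ℤ)
      (Set.range fun i => RatPolyModule.tmul N g 1 (u i)) with hU
  have key : ∀ y ∈ Submodule.span (MvPolynomial (Fin k) ℤ) (Set.range u), ∀ q : ℚ,
      RatPolyModule.tmul N g q y ∈ U := by
    intro y hy
    induction hy using Submodule.span_induction with
    | mem x hx =>
      obtain ⟨i, rfl⟩ := hx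
      intro q
      have h1 : RatPolyModule.tmul N g 1 (u i) ∈ U := Submodule.subset_span ⟨i, rfl⟩
      have := U.smul_mem (q ⊗ₜ[ℤ] 1) h1
      rwa [RatPolyModule.tmul_smul_tmul, mul_one, one_smul] at this
    | zero =>
      intro q
      have : RatPolyModule.tmul N g q 0 = 0 := TensorProduct.tmul_zero _ _
      rw [this]
      exact U.zero_mem
    | add x y _ _ hx hy =>
      intro q
      rw [RatPolyModule.tmul_add]
      exact add_mem (hx q) (hy q)
    | smul r x _ hx =>
      intro q
      have := U.smul_mem (1 ⊗ₜ[ℤ] r) (hx q)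
      rwa [RatPolyModule.tmul_smul_tmul, one_mul] at this
  intro x _
  induction x using RatPolyModule.induction with
  | h0 => exact U.zero_mem
  | htmul q n =>
    have := key _ (hu n) (q / c)
    rwa [RatPolyModule.tmul_nsmul, div_mul_cancel₀ _ (by exact_mod_cast hc.ne')] at this
  | hadd x y hx hy => exact add_mem (hx trivial) (hy trivial)

/-- If a submodule generated by `e` elements has finite index in `N`, then `ℚ ⊗ N` is generated
by `e` elements. -/
theorem RatPolyModule.spanFinrank_le {e : ℕ} (u : Fin e → PolyModule N g) {c : ℕ} (hc : 0 < c)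
    (hu : ∀ x, c • x ∈ Submodule.span (MvPolynomial (Fin k) ℤ) (Set.range u)) :
    Submodule.spanFinrank
      (⊤ : Submodule (ℚ ⊗[ℤ] MvPolynomial (Fin k) ℤ) (RatPolyModule N g)) ≤ e := by
  rw [← RatPolyModule.span_tmul_eq_top N g u hc hu]
  refine (Submodule.spanFinrank_span_le_ncard_of_finite (Set.finite_range _)).trans ?_
  rw [← Set.image_univ]
  exact (Set.ncard_image_le Set.finite_univ).trans (by simp)

/-- If `ℚ ⊗ N` is generated by `d` elements, then clearing denominators yields a submodule of
finite index in `N` generated by `d` elements. -/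
theorem RatPolyModule.exists_nsmul_mem_span [Group.FG N] :
    ∃ (u : Fin (Submodule.spanFinrank
      (⊤ : Submodule (ℚ ⊗[ℤ] MvPolynomial (Fin k) ℤ) (RatPolyModule N g))) → PolyModule N g)
      (c : ℕ), 0 < c ∧
      ∀ x, c • x ∈ Submodule.span (MvPolynomial (Fin k) ℤ) (Set.range u) := by
  classical
  have := PolyModule.module_finite_int N g
  have hfg : (⊤ : Submodule (ℚ ⊗[ℤ] MvPolynomial (Fin k) ℤ) (RatPolyModule N g)).FG := by
    obtain ⟨r, v, hv⟩ := Module.Finite.exists_fin (R := ℤ) (M := PolyModule N g)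
    rw [← RatPolyModule.span_tmul_eq_top N g v one_pos]
    · exact Submodule.fg_span (Set.finite_range _)
    · intro x
      have hx : x ∈ Submodule.span ℤ (Set.range v) := hv ▸ Submodule.mem_top
      rw [one_smul]
      exact Submodule.span_le_restrictScalars ℤ _ _ hx
  obtain ⟨s, hs, hspan⟩ := hfg.exists_span_finset_card_eq_spanFinrank
  rw [← hs]
  have hden : ∀ w : RatPolyModule N g, ∃ (b : ℕ) (n : PolyModule N g), 0 < b ∧
      b • w = RatPolyModule.tmul N g 1 n := by
    intro w
    induction w using RatPolyModule.induction with
    | h0 => exact ⟨1, 0, one_pos, by rw [smul_zero]; exact (TensorProduct.tmul_zero _ _).symm⟩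
    | htmul q n =>
      refine ⟨q.den, q.num • n, q.den_pos, ?_⟩
      rw [RatPolyModule.nsmul_tmul, Rat.mul_den_eq_num, RatPolyModule.tmul_one_zsmul]
    | hadd x y hx hy =>
      obtain ⟨b, n, hb, h⟩ := hx
      obtain ⟨b', n', hb', h'⟩ := hy
      refine ⟨b * b', b' • n + b • n', Nat.mul_pos hb hb', ?_⟩
      rw [smul_add, mul_comm b b', mul_smul, h, mul_comm b' b, mul_smul, h', RatPolyModule.tmul_add,
        RatPolyModule.nsmul_tmul, RatPolyModule.nsmul_tmul, RatPolyModule.tmul_nsmul,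
        RatPolyModule.tmul_nsmul]
  choose b n hb hn using hden
  let w : Fin s.card → RatPolyModule N g := fun i => (s.equivFin.symm i : RatPolyModule N g)
  let u : Fin s.card → PolyModule N g := fun i => n (w i)
  set U := Submodule.span (MvPolynomial (Fin k) ℤ) (Set.range u) with hU
  have hP : ∀ x : RatPolyModule N g, ∃ (b : ℕ) (y : PolyModule N g), 0 < b ∧ y ∈ U ∧
      b • x = RatPolyModule.tmul N g 1 y := by
    intro x
    have hx : x ∈ Submodule.span (ℚ ⊗[ℤ] MvPolynomial (Fin k) ℤ) (s : Set (RatPolyModule N g)) :=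
      hspan ▸ Submodule.mem_top
    have hzero : ∃ (b : ℕ) (y : PolyModule N g), 0 < b ∧ y ∈ U ∧
        b • (0 : RatPolyModule N g) = RatPolyModule.tmul N g 1 y :=
      ⟨1, 0, one_pos, U.zero_mem, by rw [smul_zero]; exact (TensorProduct.tmul_zero _ _).symm⟩
    have hadd' : ∀ x y : RatPolyModule N g,
        (∃ (b : ℕ) (z : PolyModule N g), 0 < b ∧ z ∈ U ∧ b • x = RatPolyModule.tmul N g 1 z) →
        (∃ (b : ℕ) (z : PolyModule N g), 0 < b ∧ z ∈ U ∧ b • y = RatPolyModule.tmul N g 1 z) →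
        ∃ (b : ℕ) (z : PolyModule N g), 0 < b ∧ z ∈ U ∧
          b • (x + y) = RatPolyModule.tmul N g 1 z := by
      rintro x y ⟨b, z, hb, hz, h⟩ ⟨b', z', hb', hz', h'⟩
      refine ⟨b * b', b' • z + b • z', Nat.mul_pos hb hb',
        add_mem (nsmul_mem hz _) (nsmul_mem hz' _), ?_⟩
      rw [smul_add, mul_comm b b', mul_smul, h, mul_comm b' b, mul_smul, h', RatPolyModule.tmul_add,
        RatPolyModule.nsmul_tmul, RatPolyModule.nsmul_tmul, RatPolyModule.tmul_nsmul,
        RatPolyModule.tmul_nsmul]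
    induction hx using Submodule.span_induction with
    | mem x hx =>
      refine ⟨b x, n x, hb x, Submodule.subset_span ⟨s.equivFin ⟨x, hx⟩, ?_⟩, hn x⟩
      simp [u, w]
    | zero => exact hzero
    | add x y _ _ hx hy => exact hadd' x y hx hy
    | smul a x _ hx =>
      obtain ⟨b, z, hb, hz, h⟩ := hx
      induction a using TensorProduct.induction_on with
      | zero =>
        obtain ⟨b, y, hb, hy, h⟩ := hzero
        exact ⟨b, y, hb, hy, (congrArg (b • ·)
          (zero_smul (ℚ ⊗[ℤ] MvPolynomial (Fin k) ℤ) x)).trans h⟩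
      | tmul q r =>
        refine ⟨q.den * b, q.num • r • z, Nat.mul_pos q.den_pos hb,
          zsmul_mem (U.smul_mem _ hz) _, ?_⟩
        rw [mul_smul, ← smul_comm (q ⊗ₜ[ℤ] r) b x, h, RatPolyModule.tmul_smul_tmul, mul_one,
          RatPolyModule.nsmul_tmul, Rat.mul_den_eq_num, RatPolyModule.tmul_one_zsmul]
      | add a a' ha ha' =>
        rw [add_smul]
        exact hadd' _ _ ha ha'
  refine ⟨u, exists_forall_nsmul_mem U.toAddSubgroup fun x => ?_⟩
  obtain ⟨b, y, hb, hy, h⟩ := hP (RatPolyModule.tmul N g 1 x)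
  have h0 : TensorProduct.mk ℤ ℚ (PolyModule N g) 1 (b • x - y) = 0 := by
    rw [map_sub, map_nsmul, sub_eq_zero]
    exact h
  -- The kernel of `N → ℚ ⊗ N` is the torsion subgroup of `N`.
  obtain ⟨⟨a, ha⟩, ha0⟩ := (IsLocalizedModule.eq_zero_iff (nonZeroDivisors ℤ) _).1 h0
  have ha1 : a ≠ 0 := nonZeroDivisors.ne_zero ha
  refine ⟨a.natAbs * b, Nat.mul_pos (Int.natAbs_pos.2 ha1) hb, ?_⟩
  have h1 : a • (b • x) ∈ U := by
    have h2 : a • (b • x - y) = 0 := ha0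
    rw [smul_sub, sub_eq_zero] at h2
    rw [h2]
    exact zsmul_mem hy _
  change (a.natAbs * b) • x ∈ U
  rw [mul_smul]
  rcases Int.natAbs_eq a with h | h
  · rwa [h, natCast_zsmul] at h1
  · rw [h, neg_smul, natCast_zsmul] at h1
    exact neg_mem_iff.1 h1

/-- Every element of `G ⧸ N` acts on `N` as some polynomial. For the inverse of `q`, this holds
as `q⁻¹` is integral over `ℤ` as an endomorphism of `N`, so it is a polynomial in `q`. -/
theorem exists_smul_of_eq_conjAct [Group.FG N] (hg : Subgroup.closure (Set.range g) = ⊤)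
    (q : G ⧸ N) : ∃ r : MvPolynomial (Fin k) ℤ, ∀ n : N,
      r • PolyModule.of N g n = PolyModule.of N g (conjAct N q n) := by
  suffices h : conjRep N q ∈ (polyAction N g).range by
    obtain ⟨r, hr⟩ := h
    refine ⟨r, fun n => ?_⟩
    exact LinearMap.congr_fun hr (Additive.ofMul n)
  have : Module.Finite ℤ (Additive N) := Module.Finite.iff_addGroup_fg.2 inferInstance
  have hq : q ∈ Subgroup.closure (Set.range g) := hg ▸ Subgroup.mem_top q
  induction hq using Subgroup.closure_induction with
  | mem x hx =>
    obtain ⟨i, rfl⟩ := hx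
    exact ⟨MvPolynomial.X i, by simp [polyAction]⟩
  | one => rw [map_one]; exact one_mem _
  | mul x y _ _ hx hy => rw [map_mul]; exact mul_mem hx hy
  | inv x _ hx =>
    set a := conjRep N x
    set b := conjRep N x⁻¹
    have hab : a * b = 1 := by rw [← map_mul, mul_inv_cancel, map_one]
    have hba : b * a = 1 := by rw [← map_mul, inv_mul_cancel, map_one]
    obtain ⟨p, hp, hp0⟩ := Algebra.IsIntegral.isIntegral (R := ℤ) b
    -- Multiply the equation `b ^ m + ∑ c_i b ^ i = 0` by `a ^ (m - 1)`.
    have hpow : ∀ i m : ℕ, i ≤ m → b ^ i * a ^ m = a ^ (m - i) := by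
      intro i m him
      obtain ⟨j, rfl⟩ := Nat.exists_eq_add_of_le him
      have hc : Commute b a := hba.trans hab.symm
      rw [pow_add, ← mul_assoc, ← hc.mul_pow, hba, one_pow, one_mul, Nat.add_sub_cancel_left]
    have hmem : ∀ i, a ^ i ∈ (polyAction N g).range := fun i => pow_mem hx i
    rcases Nat.eq_zero_or_pos p.natDegree with h0 | hpos
    · have h1 : (1 : Module.End ℤ (Additive N)) = 0 := by
        rw [Polynomial.eq_one_of_monic_natDegree_zero hp h0] at hp0
        simpa using hp0
      have : b = 0 := by rw [← mul_one b, h1, mul_zero]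
      rw [this]
      exact zero_mem _
    · rw [Polynomial.eval₂_eq_sum_range, Finset.sum_range_succ, hp.coeff_natDegree, map_one,
        one_mul] at hp0
      have h2 := congrArg (· * a ^ (p.natDegree - 1)) hp0
      simp only [add_mul, zero_mul, Finset.sum_mul] at h2
      have h3 : b ^ p.natDegree * a ^ (p.natDegree - 1) = b := by
        obtain ⟨m, hm⟩ := Nat.exists_eq_succ_of_ne_zero hpos.ne'
        rw [hm, Nat.succ_sub_one, Nat.succ_eq_add_one, pow_succ', mul_assoc, hpow m m le_rfl,
          Nat.sub_self, pow_zero, mul_one]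
      rw [h3] at h2
      rw [← neg_eq_of_add_eq_zero_right h2]
      refine neg_mem (sum_mem fun i hi => ?_)
      rw [mul_assoc, hpow i _ (Nat.le_sub_one_of_lt (Finset.mem_range.1 hi))]
      exact mul_mem (Subalgebra.algebraMap_mem _ _) (hmem _)

end ConjugationModule

/-! ### Normal maximal subgroups -/

section Normal

variable {G : Type*} [Group G] (N : Subgroup G) [N.Normal] [IsMulCommutative (G ⧸ N)]

omit [N.Normal] [IsMulCommutative (G ⧸ N)] in
theorem Subgroup.normal_of_commutator_le {H : Subgroup G} (h : _root_.commutator G ≤ H) : H.Normal where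
  conj_mem x hx a := by
    have := mul_mem (h (commutator_mem_commutator (mem_top a) (mem_top x))) hx
    rwa [commutatorElement_def, inv_mul_cancel_right] at this

theorem commutator_le_of_isMulCommutative_quotient : commutator G ≤ N :=
  Subgroup.Normal.quotient_commutative_iff_commutator_le.1 inferInstance

theorem module_finite_additive_quotient {k : ℕ} (g : Fin k → G ⧸ N)
    (hg : Subgroup.closure (Set.range g) = ⊤) : Module.Finite ℤ (Additive (G ⧸ N)) := by
  have : Group.FG (G ⧸ N) := Group.fg_iff.2 ⟨_, hg, Set.finite_range _⟩
  exact Module.Finite.iff_addGroup_fg.2 inferInstance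

variable [IsMulCommutative N]

include N in
theorem commutator_le_of_isCoatom_of_normal {M : Subgroup G} (hM : IsCoatom M) [M.Normal] :
    commutator G ≤ M := by
  by_cases hN : N ≤ M
  · exact (commutator_le_of_isMulCommutative_quotient N).trans hN
  · refine Subgroup.Normal.commutator_le_of_self_sup_commutative_eq_top (H := N) ?_ inferInstance
    refine hM.2 _ (lt_of_le_of_ne le_sup_left fun h => hN ?_)
    rw [h]
    exact le_sup_right

variable {k : ℕ} (g : Fin k → G ⧸ N)

/-- The homomorphism from `N` to the abelianization of `G`. -/
def PolyModule.toAbelianization : PolyModule N g →ₗ[ℤ] Additive (Abelianization G) :=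
  (MonoidHom.toAdditive (Abelianization.of.comp N.subtype)).toIntLinearMap

theorem PolyModule.toAbelianization_smul {r : MvPolynomial (Fin k) ℤ} (hr : r ∈ augIdeal k)
    (x : PolyModule N g) : PolyModule.toAbelianization N g (r • x) = 0 := by
  induction hr using Submodule.span_induction generalizing x with
  | mem r hr =>
    obtain ⟨i, rfl⟩ := hr
    obtain ⟨a, ha⟩ := QuotientGroup.mk_surjective (g i)
    obtain ⟨n, rfl⟩ : ∃ n, PolyModule.of N g n = x := ⟨Additive.toMul x, rfl⟩
    simp only []
    rw [sub_smul, one_smul, map_sub, sub_eq_zero, PolyModule.X_smul N g i a ha.symm]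
    have h : Abelianization.of (a * n * a⁻¹) = Abelianization.of (n : G) := by
      rw [map_mul, map_mul, map_inv, mul_right_comm, mul_inv_cancel, one_mul]
    exact congrArg Additive.ofMul h
  | zero => rw [zero_smul, map_zero]
  | add r s _ _ hr hs => rw [add_smul, map_add, hr, hs, add_zero]
  | smul a r _ hr => rw [smul_eq_mul, mul_comm, mul_smul, hr]

/-- The abelianization of `G` is an extension of `G ⧸ N` by a quotient of `N / I N`. -/
theorem finrank_abelianization_le [Group.FG N] (hg : Subgroup.closure (Set.range g) = ⊤) :
    Module.Finite ℤ (Additive (Abelianization G)) ∧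
    Module.finrank ℤ (Additive (Abelianization G)) ≤
      torsionFreeRank (Additive (G ⧸ N)) + torsionFreeRank (PolyModule.Coinvariants N g) := by
  have := PolyModule.module_finite_int N g
  have hQ := module_finite_additive_quotient N g hg
  set φ := PolyModule.toAbelianization N g
  let I : Submodule (MvPolynomial (Fin k) ℤ) (PolyModule N g) := augIdeal k • ⊤
  have hI : I.restrictScalars ℤ ≤ LinearMap.ker φ := by
    intro x hx
    have hx' : x ∈ I := hx
    rw [LinearMap.mem_ker]
    refine Submodule.smul_induction_on hx' (fun r hr n _ => ?_) (fun x y hx hy => ?_)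
    · exact PolyModule.toAbelianization_smul N g hr n
    · rw [map_add, hx, hy, add_zero]
  let φ' : PolyModule.Coinvariants N g →ₗ[ℤ] Additive (Abelianization G) :=
    ((Submodule.liftQ _ φ hI).comp
      (Submodule.Quotient.restrictScalarsEquiv ℤ I).symm.toLinearMap)
  have hφ' : ∀ n : N, φ' (Submodule.Quotient.mk (PolyModule.of N g n)) =
      Additive.ofMul (Abelianization.of (n : G)) := fun n => rfl
  set B := LinearMap.range φ'
  let ψ₀ : G →* Multiplicative (Additive (Abelianization G) ⧸ B) :=
    (AddMonoidHom.toMultiplicative B.mkQ.toAddMonoidHom).comp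
      (MulEquiv.toMonoidHom (MulEquiv.refl _) |>.comp Abelianization.of)
  let ψ : Additive (G ⧸ N) →ₗ[ℤ] Additive (Abelianization G) ⧸ B :=
    (MonoidHom.toAdditiveLeft (QuotientGroup.lift N ψ₀ (by
      intro n hn
      exact (Submodule.Quotient.mk_eq_zero B).2 ⟨_, hφ' ⟨n, hn⟩⟩))).toIntLinearMap
  have hψ : Function.Surjective ψ := by
    intro y
    obtain ⟨y, rfl⟩ := B.mkQ_surjective y
    obtain ⟨x, hx⟩ := QuotientGroup.mk_surjective (Additive.toMul y)
    refine ⟨Additive.ofMul (QuotientGroup.mk x), ?_⟩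
    change B.mkQ (Additive.ofMul (Abelianization.of x)) = _
    exact congrArg (fun z => B.mkQ (Additive.ofMul z)) hx
  have hfinC : Module.Finite ℤ (PolyModule.Coinvariants N g) :=
    PolyModule.module_finite_int_quotient N g _
  have hfinB : Module.Finite ℤ B := Module.Finite.range φ'
  have hfinAB : Module.Finite ℤ (Additive (Abelianization G) ⧸ B) :=
    Module.Finite.of_surjective ψ hψ
  have hfinA := Module.Finite.of_submodule_quotient B
  refine ⟨hfinA, ?_⟩
  rw [← B.finrank_quotient_add_finrank]
  exact add_le_add (LinearMap.finrank_le_finrank_of_surjective hψ) (LinearMap.finrank_range_le φ')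

/-- The normal maximal subgroups of index `n` correspond to maximal subgroups of the
abelianization. -/
theorem exists_ncard_normal_mul_le [Group.FG N] (hg : Subgroup.closure (Set.range g) = ⊤) :
    ∃ C n₀ : ℕ, ∀ n ≥ n₀,
      {M : Subgroup G | IsCoatom M ∧ M.index = n ∧ M.Normal}.Finite ∧
      {M : Subgroup G | IsCoatom M ∧ M.index = n ∧ M.Normal}.ncard * n ≤
        C * n ^ (torsionFreeRank (Additive (G ⧸ N)) +
          torsionFreeRank (PolyModule.Coinvariants N g)) := by
  obtain ⟨hfin, hrank⟩ := finrank_abelianization_le N g hg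
  obtain ⟨u, c, hc, hu⟩ := exists_nsmul_mem_span_finrank (A := Additive (Abelianization G))
  obtain ⟨C, n₀, hC⟩ := exists_ncard_isCoatom_mul_le u hc hu
  refine ⟨C, n₀ + 1, fun n hn => ?_⟩
  obtain ⟨hSfin, hScard⟩ := hC n (by omega)
  let F : Subgroup G → Submodule ℤ (Additive (Abelianization G)) := fun M =>
    AddSubgroup.toIntSubmodule (Subgroup.toAddSubgroup (M.map Abelianization.of))
  have hsurj : Function.Surjective (Abelianization.of : G →* Abelianization G) :=
    QuotientGroup.mk_surjective
  have hker : ∀ M : Subgroup G, IsCoatom M → M.Normal →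
      (Abelianization.of : G →* Abelianization G).ker ≤ M := by
    intro M hM hMn
    rw [Abelianization.ker_of]
    exact commutator_le_of_isCoatom_of_normal N hM
  have hcomap : ∀ M : Subgroup G, IsCoatom M → M.Normal →
      (M.map Abelianization.of).comap Abelianization.of = M := fun M hM hMn =>
    Subgroup.comap_map_eq_self (hker M hM hMn)
  have hmaps : Set.MapsTo F {M : Subgroup G | IsCoatom M ∧ M.index = n ∧ M.Normal}
      {K | IsCoatom K ∧ Nat.card (Additive (Abelianization G) ⧸ K) = n} := by
    rintro M ⟨hM, hMn, hMnormal⟩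
    constructor
    · rw [OrderIso.isCoatom_iff, OrderIso.isCoatom_iff]
      constructor
      · intro h
        have := hcomap M hM hMnormal
        rw [h, Subgroup.comap_top] at this
        exact hM.1 this.symm
      · intro L hL
        have hlt : M < L.comap Abelianization.of := by
          rw [← hcomap M hM hMnormal]
          exact (Subgroup.comap_lt_comap_of_surjective hsurj).2 hL
        rw [← Subgroup.map_comap_eq_self_of_surjective hsurj L, hM.2 _ hlt,
          Subgroup.map_top_of_surjective _ hsurj]
    · rw [← hMn, ← Subgroup.index_map_eq M hsurj (hker M hM hMnormal)]
      rfl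
  have hinj : Set.InjOn F {M : Subgroup G | IsCoatom M ∧ M.index = n ∧ M.Normal} := by
    rintro M ⟨hM, -, hMn⟩ M' ⟨hM', -, hMn'⟩ h
    have h' : M.map Abelianization.of = M'.map Abelianization.of :=
      Subgroup.toAddSubgroup.injective (AddSubgroup.toIntSubmodule.injective h)
    rw [← hcomap M hM hMn, h', hcomap M' hM' hMn']
  refine ⟨Set.Finite.of_injOn hmaps hinj hSfin, ?_⟩
  calc _ ≤ _ := Nat.mul_le_mul_right n (Set.ncard_le_ncard_of_injOn F hmaps hinj hSfin)
    _ ≤ C * n ^ _ := hScard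
    _ ≤ _ := Nat.mul_le_mul_left C (Nat.pow_le_pow_right (by omega) hrank)

end Normal

/-! ### Maximal subgroups that are not normal -/

section NonNormal

/-- An additive subgroup stable under the variables is a submodule. -/
theorem MvPolynomial.smul_mem_of_forall_X_smul_mem {σ M : Type*} [AddCommGroup M]
    [Module (MvPolynomial σ ℤ) M] (K : AddSubgroup M)
    (hK : ∀ i, ∀ x ∈ K, (MvPolynomial.X i : MvPolynomial σ ℤ) • x ∈ K)
    (r : MvPolynomial σ ℤ) {x : M} (hx : x ∈ K) : r • x ∈ K := by
  induction r using MvPolynomial.induction_on generalizing x with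
  | C a =>
    rw [← MvPolynomial.algebraMap_eq, algebraMap_smul]
    exact zsmul_mem hx a
  | add p q hp hq => rw [add_smul]; exact add_mem (hp hx) (hq hx)
  | mul_X p i hp => rw [mul_smul]; exact hp (hK i x hx)

variable {G : Type*} [Group G] {N : Subgroup G} [N.Normal]

theorem exists_inv_mul_mem_of_isCoatom {M : Subgroup G} (hM : IsCoatom M) (hN : ¬ N ≤ M) (a : G) :
    ∃ n ∈ N, n⁻¹ * a ∈ M := by
  have htop : N ⊔ M = ⊤ := hM.2 _ (lt_of_le_of_ne le_sup_right fun h => hN (h ▸ le_sup_left))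
  have ha : a ∈ ((N ⊔ M : Subgroup G) : Set G) := htop ▸ Subgroup.mem_top a
  rw [Subgroup.normal_mul] at ha
  obtain ⟨n, hn, m, hm, rfl⟩ := Set.mem_mul.1 ha
  exact ⟨n, hn, by simpa using hm⟩

theorem index_subgroupOf_of_isCoatom {M : Subgroup G} (hM : IsCoatom M) (hN : ¬ N ≤ M) :
    (M.subgroupOf N).index = M.index := by
  have hiff : ∀ x y : N, (x : G)⁻¹ * y ∈ M ↔ x⁻¹ * y ∈ M.subgroupOf N := fun x y => Iff.rfl
  refine Nat.card_eq_of_bijective (Quotient.map' (fun x : N => (x : G)) fun x y h =>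
    QuotientGroup.leftRel_apply.2 ((hiff x y).2 (QuotientGroup.leftRel_apply.1 h))) ⟨?_, ?_⟩
  · intro x y
    induction x using Quotient.inductionOn'
    induction y using Quotient.inductionOn'
    intro h
    rw [Quotient.map'_mk'', Quotient.map'_mk'', Quotient.eq'', QuotientGroup.leftRel_apply] at h
    exact Quotient.eq''.2 (QuotientGroup.leftRel_apply.2 h)
  · intro y
    induction y using Quotient.inductionOn' with | _ a
    obtain ⟨n, hn, hm⟩ := exists_inv_mul_mem_of_isCoatom hM hN a
    exact ⟨Quotient.mk'' ⟨n, hn⟩, Quotient.eq''.2 (QuotientGroup.leftRel_apply.2 hm)⟩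

omit [N.Normal] in
theorem mul_comm_of_mem [IsMulCommutative N] {x y : G} (hx : x ∈ N) (hy : y ∈ N) :
    x * y = y * x :=
  congrArg Subtype.val (mul_comm' (⟨x, hx⟩ : N) ⟨y, hy⟩)

theorem inf_normal_of_isCoatom [IsMulCommutative N] {M : Subgroup G} (hM : IsCoatom M)
    (hN : ¬ N ≤ M) : (M ⊓ N).Normal where
  conj_mem x hx a := by
    obtain ⟨n, hn, hm⟩ := exists_inv_mul_mem_of_isCoatom hM hN a
    refine ⟨?_, Subgroup.Normal.conj_mem inferInstance x hx.2 a⟩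
    -- Write `a = n * m` with `m ∈ M`; conjugation by `n` is trivial on `N`.
    have h1 : (n⁻¹ * a) * x * (n⁻¹ * a)⁻¹ ∈ N := Subgroup.Normal.conj_mem inferInstance x hx.2 _
    have h2 : a * x * a⁻¹ = n * ((n⁻¹ * a) * x * (n⁻¹ * a)⁻¹) * n⁻¹ := by group
    change a * x * a⁻¹ ∈ M
    rw [h2, mul_comm_of_mem hn h1, mul_inv_cancel_right]
    exact mul_mem (mul_mem hm hx.1) (inv_mem hm)

theorem mul_mul_inv_mul_inv_mem [IsMulCommutative (G ⧸ N)] (a b : G) : a * b * a⁻¹ * b⁻¹ ∈ N :=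
  commutator_le_of_isMulCommutative_quotient N
    (Subgroup.commutator_mem_commutator (Subgroup.mem_top a) (Subgroup.mem_top b))

/-- A complement `M` of `N` modulo `M ∩ N` contains the centralizer modulo `M ∩ N` of each
`y ∈ M` whose conjugation action on `N / (M ∩ N)` has no nontrivial fixed points. -/
theorem mem_of_commutator_mem [IsMulCommutative N] [IsMulCommutative (G ⧸ N)] {M : Subgroup G}
    (hM : IsCoatom M) (hN : ¬ N ≤ M) {n z a : G}
    (hz : ∀ b ∈ N, z * b * z⁻¹ * b⁻¹ ∈ M → b ∈ M) (hn : n ∈ N) (hnz : n * z ∈ M)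
    (ha : a * (n * z) * a⁻¹ * (n * z)⁻¹ ∈ M) : a ∈ M := by
  obtain ⟨b, hb, hm⟩ := exists_inv_mul_mem_of_isCoatom hM hN a
  suffices h : (z * b * z⁻¹ * b⁻¹)⁻¹ ∈ M by
    have := mul_mem (hz b hb (inv_mem_iff.1 h)) hm
    rwa [mul_inv_cancel_left] at this
  obtain ⟨m, rfl⟩ : ∃ m, a = b * m := ⟨b⁻¹ * a, by rw [mul_inv_cancel_left]⟩
  rw [inv_mul_cancel_left] at hm
  -- Up to the element `m y m⁻¹ y⁻¹` of `M`, the commutator of `b * m` with `y` is that of `b`.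
  set w := m * (n * z) * m⁻¹ * (n * z)⁻¹ with hw
  have hwM : w ∈ M := mul_mem (mul_mem (mul_mem hm hnz) (inv_mem hm)) (inv_mem hnz)
  have hwN : w ∈ N := mul_mul_inv_mul_inv_mem _ _
  have hzb : z * b⁻¹ * z⁻¹ ∈ N := Subgroup.Normal.conj_mem inferInstance _ (inv_mem hb) z
  have h1 : b * m * (n * z) * (b * m)⁻¹ * (n * z)⁻¹ = w * (z * b * z⁻¹ * b⁻¹)⁻¹ := calc
    _ = (b * w) * b⁻¹ * (b * (n * (z * b⁻¹ * z⁻¹) * n⁻¹)) := by rw [hw]; group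
    _ = w * (b * (z * b⁻¹ * z⁻¹)) := by
      rw [mul_comm_of_mem hb hwN, mul_inv_cancel_right, mul_comm_of_mem hn hzb,
        mul_inv_cancel_right]
    _ = w * (z * b * z⁻¹ * b⁻¹)⁻¹ := by group
  rw [h1] at ha
  exact (mul_mem_cancel_left hwM).1 ha

omit [N.Normal] in
theorem PolyModule.of_surjective {k : ℕ} (g : Fin k → G ⧸ N) :
    Function.Surjective (PolyModule.of N g) :=
  fun x => ⟨Additive.toMul x, rfl⟩

variable (N) [IsMulCommutative N] [IsMulCommutative (G ⧸ N)] {k : ℕ} (g : Fin k → G ⧸ N)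

/-- The submodule of `N` given by the intersection of `N` with a subgroup `M`, when the
intersection is normal in `G`. -/
def PolyModule.inter (M : Subgroup G) (hM : (M ⊓ N).Normal) :
    Submodule (MvPolynomial (Fin k) ℤ) (PolyModule N g) :=
  let K : AddSubgroup (PolyModule N g) := Subgroup.toAddSubgroup (M.subgroupOf N)
  { K with
    smul_mem' := fun r x hx => by
      refine MvPolynomial.smul_mem_of_forall_X_smul_mem K (fun i x hx => ?_) r hx
      obtain ⟨n, rfl⟩ := PolyModule.of_surjective g x
      obtain ⟨a, ha⟩ := QuotientGroup.mk_surjective (g i)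
      rw [PolyModule.X_smul N g i a ha.symm]
      exact (hM.conj_mem n ⟨hx, n.2⟩ a).1 }

theorem PolyModule.card_quotient_inter {M : Subgroup G} (hM : IsCoatom M) (hN : ¬ N ≤ M) :
    Nat.card (PolyModule N g ⧸ PolyModule.inter N g M (inf_normal_of_isCoatom hM hN)) =
      M.index := by
  rw [← index_subgroupOf_of_isCoatom hM hN, ← Subgroup.index_toAddSubgroup]
  rfl

variable [Group.FG N]

theorem PolyModule.isCoatom_inter (hg : Subgroup.closure (Set.range g) = ⊤) {M : Subgroup G}
    (hM : IsCoatom M) (hN : ¬ N ≤ M) :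
    IsCoatom (PolyModule.inter N g M (inf_normal_of_isCoatom hM hN)) := by
  constructor
  · intro h
    refine hN fun n hn => ?_
    have : PolyModule.of N g ⟨n, hn⟩ ∈ PolyModule.inter N g M (inf_normal_of_isCoatom hM hN) :=
      h ▸ Submodule.mem_top
    exact this
  · intro K' hK'
    let L : Subgroup G := (AddSubgroup.toSubgroup' (G := N) K'.toAddSubgroup).map N.subtype
    have hL : ∀ n : N, PolyModule.of N g n ∈ K' ↔ (n : G) ∈ L := fun n =>
      ⟨fun h => ⟨n, h, rfl⟩, fun ⟨n', h, hn⟩ => Subtype.ext hn ▸ h⟩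
    have hLN : L ≤ N := by
      rintro _ ⟨n, -, rfl⟩
      exact n.2
    have hLnormal : L.Normal := by
      constructor
      rintro x hx a
      have hxN := hLN hx
      obtain ⟨r, hr⟩ := exists_smul_of_eq_conjAct N g hg (QuotientGroup.mk a)
      have h1 := K'.smul_mem r ((hL ⟨x, hxN⟩).2 hx)
      rw [hr] at h1
      exact (hL _).1 h1
    obtain ⟨x, hxK', hx⟩ := SetLike.exists_of_lt hK'
    obtain ⟨x, rfl⟩ := PolyModule.of_surjective g x
    have htop : L ⊔ M = ⊤ := hM.2 _ (lt_of_le_of_ne le_sup_right fun h =>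
      hx (h ▸ Subgroup.mem_sup_left ((hL x).1 hxK') : (x : G) ∈ M))
    rw [eq_top_iff]
    intro y _
    obtain ⟨y, rfl⟩ := PolyModule.of_surjective g y
    have hy : (y : G) ∈ ((L ⊔ M : Subgroup G) : Set G) := htop ▸ Subgroup.mem_top _
    rw [Subgroup.normal_mul] at hy
    obtain ⟨l, hl, m, hm, hlm⟩ := Set.mem_mul.1 hy
    -- The modular law: `N = L M` with `L ≤ N` gives `N = L (M ∩ N)`.
    have hmN : m ∈ N := by
      have := mul_mem (inv_mem (hLN hl)) y.2
      rwa [← hlm, inv_mul_cancel_left] at this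
    have hmK : PolyModule.of N g ⟨m, hmN⟩ ∈ K' := hK'.le hm
    have hlK : PolyModule.of N g ⟨l, hLN hl⟩ ∈ K' := (hL _).2 hl
    have := add_mem hlK hmK
    rwa [show y = ⟨l, hLN hl⟩ * ⟨m, hmN⟩ from Subtype.ext hlm.symm]

/-- For a maximal subgroup `M` that is not normal, some element of `G` acts on `N / (M ∩ N)`
without nontrivial fixed points. -/
theorem exists_forall_mem_of_commutator_mem (hg : Subgroup.closure (Set.range g) = ⊤)
    {M : Subgroup G} (hM : IsCoatom M) (hN : ¬ N ≤ M) (hMn : ¬ M.Normal) :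
    ∃ z : G, ∀ b ∈ N, z * b * z⁻¹ * b⁻¹ ∈ M → b ∈ M := by
  obtain ⟨z, b₀, hb₀, hzb₀⟩ : ∃ z, ∃ b ∈ N, z * b * z⁻¹ * b⁻¹ ∉ M := by
    by_contra! hcon
    refine hMn ⟨fun x hx a => ?_⟩
    obtain ⟨n, hn, hm⟩ := exists_inv_mul_mem_of_isCoatom hM hN a
    obtain ⟨m, rfl⟩ : ∃ m, a = n * m := ⟨n⁻¹ * a, by rw [mul_inv_cancel_left]⟩
    rw [inv_mul_cancel_left] at hm
    have h1 : m * x * m⁻¹ ∈ M := mul_mem (mul_mem hm hx) (inv_mem hm)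
    have h2 := mul_mem (inv_mem (hcon (m * x * m⁻¹) n hn)) h1
    have h3 : (m * x * m⁻¹ * n * (m * x * m⁻¹)⁻¹ * n⁻¹)⁻¹ * (m * x * m⁻¹) =
      n * m * x * (n * m)⁻¹ := by group
    rwa [h3] at h2
  refine ⟨z, ?_⟩
  set K := PolyModule.inter N g M (inf_normal_of_isCoatom hM hN) with hK
  obtain ⟨r, hr⟩ := exists_smul_of_eq_conjAct N g hg (QuotientGroup.mk z)
  let K' : Submodule (MvPolynomial (Fin k) ℤ) (PolyModule N g) :=
    K.comap (LinearMap.lsmul _ _ (r - 1))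
  have hK' : ∀ n : N, PolyModule.of N g n ∈ K' ↔ z * n * z⁻¹ * (n : G)⁻¹ ∈ M := by
    intro n
    rw [Submodule.mem_comap, LinearMap.lsmul_apply, sub_smul, one_smul, hr, sub_eq_add_neg]
    exact Iff.rfl
  have hle : K ≤ K' := fun x hx => K.smul_mem _ hx
  have heq : K' = K := by
    by_contra hne
    have htop := (PolyModule.isCoatom_inter N g hg hM hN).2 K' (lt_of_le_of_ne hle (Ne.symm hne))
    exact hzb₀ ((hK' ⟨b₀, hb₀⟩).1 (htop ▸ Submodule.mem_top))
  intro b hb h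
  have := (hK' ⟨b, hb⟩).2 h
  rw [heq] at this
  exact this

/-- A maximal subgroup `M` of index `n` that is not normal determines the maximal submodule
`K = M ∩ N` of index `n`, and is determined by `K` and a coset in `N / K`. -/
theorem exists_ncard_not_normal_le (hg : Subgroup.closure (Set.range g) = ⊤) :
    ∃ C n₀ : ℕ, ∀ n ≥ n₀,
      {M : Subgroup G | IsCoatom M ∧ M.index = n ∧ ¬ M.Normal}.Finite ∧
      {M : Subgroup G | IsCoatom M ∧ M.index = n ∧ ¬ M.Normal}.ncard ≤
        C * n ^ Submodule.spanFinrank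
          (⊤ : Submodule (ℚ ⊗[ℤ] MvPolynomial (Fin k) ℤ) (RatPolyModule N g)) := by
  classical
  have := PolyModule.module_finite_int N g
  obtain ⟨u, c, hc, hu⟩ := RatPolyModule.exists_nsmul_mem_span N g
  obtain ⟨C, n₀, hC⟩ := exists_ncard_isCoatom_mul_le u hc hu
  refine ⟨C, n₀ + 1, fun n hn => ?_⟩
  obtain ⟨hSfin, hScard⟩ := hC n (by omega)
  set S := {K : Submodule (MvPolynomial (Fin k) ℤ) (PolyModule N g) |
    IsCoatom K ∧ Nat.card (PolyModule N g ⧸ K) = n} with hS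
  set B := {M : Subgroup G | IsCoatom M ∧ M.index = n ∧ ¬ M.Normal} with hB
  have hBN : ∀ M : B, ¬ N ≤ M.1 := fun M h => M.2.2.2 (Subgroup.normal_of_commutator_le
    ((commutator_le_of_isMulCommutative_quotient N).trans h))
  let K : B → S := fun M =>
    ⟨PolyModule.inter N g M.1 (inf_normal_of_isCoatom M.2.1 (hBN M)),
      PolyModule.isCoatom_inter N g hg M.2.1 (hBN M),
      (PolyModule.card_quotient_inter N g M.2.1 (hBN M)).trans M.2.2.1⟩
  have hK : ∀ (M : B) (x : N), PolyModule.of N g x ∈ (K M).1 ↔ (x : G) ∈ M.1 :=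
    fun M x => Iff.rfl
  -- The element `z` depends on the submodule `M ∩ N` only, not on `M`.
  have hz : ∀ K₀ : S, ∃ z : G, ∀ M : B, K M = K₀ →
      ∀ b ∈ N, z * b * z⁻¹ * b⁻¹ ∈ M.1 → b ∈ M.1 := by
    intro K₀
    by_cases h : ∃ M : B, K M = K₀
    · obtain ⟨M, rfl⟩ := h
      obtain ⟨z, hz⟩ := exists_forall_mem_of_commutator_mem N g hg M.2.1 (hBN M) M.2.2.2
      refine ⟨z, fun M' hM' b hb h => ?_⟩
      have h1 : z * b * z⁻¹ * b⁻¹ ∈ M.1 := by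
        have := (hK M' ⟨_, mul_mul_inv_mul_inv_mem z b⟩).2 h
        rw [hM'] at this
        exact this
      have := (hK M ⟨b, hb⟩).2 (hz b hb h1)
      rw [← hM'] at this
      exact this
    · exact ⟨1, fun M hM => absurd ⟨M, hM⟩ h⟩
  choose z hz using hz
  have hv : ∀ M : B, ∃ v : N, (v : G) * z (K M) ∈ M.1 := by
    intro M
    obtain ⟨v, hv, hm⟩ := exists_inv_mul_mem_of_isCoatom M.2.1 (hBN M) (z (K M))
    exact ⟨⟨v, hv⟩⁻¹, hm⟩
  choose v hv using hv
  let F : B → Σ K₀ : S, PolyModule N g ⧸ K₀.1 := fun M =>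
    ⟨K M, Submodule.Quotient.mk (PolyModule.of N g (v M))⟩
  have hF : Function.Injective F := by
    intro M M' h
    have hKK : K M = K M' := congrArg Sigma.fst h
    have hvv : (v M : G) * (v M' : G)⁻¹ ∈ M'.1 := by
      have h2 : ∀ (K₀ : S), K M = K₀ → ∀ w : PolyModule N g,
          F M = ⟨K₀, Submodule.Quotient.mk w⟩ → PolyModule.of N g (v M) - w ∈ K₀.1 := by
        rintro K₀ rfl w h
        exact (Submodule.Quotient.eq _).1 (eq_of_heq (Sigma.mk.inj h).2)
      have h3 := h2 (K M') hKK _ h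
      rw [sub_eq_add_neg] at h3
      exact h3
    have hy : (v M : G) * z (K M) ∈ M'.1 := by
      have := mul_mem hvv (hv M')
      rwa [← hKK, ← mul_assoc, inv_mul_cancel_right] at this
    have hle : M.1 ≤ M'.1 := by
      intro a ha
      refine mem_of_commutator_mem M'.2.1 (hBN M') (hz (K M) M' hKK.symm) (v M).2 hy ?_
      have h1 := mul_mem (mul_mem (mul_mem ha (hv M)) (inv_mem ha)) (inv_mem (hv M))
      have h2 := (hK M ⟨_, mul_mul_inv_mul_inv_mem a ((v M : G) * z (K M))⟩).2 h1
      have h3 : ∀ K₀ : S, K M = K₀ →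
          PolyModule.of N g ⟨_, mul_mul_inv_mul_inv_mem a ((v M : G) * z (K M))⟩ ∈ K₀.1 := by
        rintro _ rfl
        exact h2
      exact h3 _ hKK
    by_contra hne
    exact M'.2.1.1 (M.2.1.2 _ (lt_of_le_of_ne hle fun h => hne (Subtype.ext h)))
  have : Finite S := hSfin
  have hfib : ∀ K₀ : S, Finite (PolyModule N g ⧸ K₀.1) := fun K₀ =>
    Nat.finite_of_card_ne_zero (by rw [K₀.2.2]; omega)
  refine ⟨Finite.of_injective F hF, ?_⟩
  refine (Nat.card_le_card_of_injective F hF).trans (le_trans (le_of_eq ?_) hScard)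
  have := Fintype.ofFinite S
  rw [Nat.card_sigma, Finset.sum_congr rfl fun (K₀ : S) _ => K₀.2.2, Finset.sum_const,
    Finset.card_univ, smul_eq_mul, ← Nat.card_eq_fintype_card]
  rfl

end NonNormal

/-! ### Maximal subgroups as kernels of crossed homomorphisms -/

section CrossedHom

variable {H K : Type*} [Group H] [CommRing K] [IsDomain K]

omit [IsDomain K] in
theorem crossedHom_one {χ : H →* K} {D : H → K} (hD : ∀ x y, D (x * y) = D x + χ x * D y) :
    D 1 = 0 := by
  have := hD 1 1
  rw [mul_one, map_one, one_mul] at this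
  exact left_eq_add.1 this

omit [IsDomain K] in
theorem crossedHom_inv {χ : H →* K} {D : H → K} (hD : ∀ x y, D (x * y) = D x + χ x * D y) (x : H) :
    D x⁻¹ = -(χ x⁻¹ * D x) := by
  have := hD x⁻¹ x
  rw [inv_mul_cancel, crossedHom_one hD] at this
  exact eq_neg_of_add_eq_zero_left this.symm

/-- The zero set of a crossed homomorphism `D`, that is, of a map `D` to a ring on which the group
acts by a character `χ` such that `D (x * y) = D x + χ x * D y`. -/
def crossedHomKer (χ : H →* K) (D : H → K) (hD : ∀ x y, D (x * y) = D x + χ x * D y) :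
    Subgroup H where
  carrier := {x | D x = 0}
  one_mem' := crossedHom_one hD
  mul_mem' {x y} (hx : D x = 0) (hy : D y = 0) := by
    change D (x * y) = 0
    rw [hD, hx, hy, mul_zero, add_zero]
  inv_mem' {x} (hx : D x = 0) := by
    change D x⁻¹ = 0
    rw [crossedHom_inv hD, hx, mul_zero, neg_zero]

omit [IsDomain K] in
theorem mem_crossedHomKer {χ : H →* K} {D : H → K} {hD : ∀ x y, D (x * y) = D x + χ x * D y}
    {x : H} : x ∈ crossedHomKer χ D hD ↔ D x = 0 := Iff.rfl

theorem index_crossedHomKer {χ : H →* K} {D : H → K} (hD : ∀ x y, D (x * y) = D x + χ x * D y)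
    (hsurj : Function.Surjective D) : (crossedHomKer χ D hD).index = Nat.card K := by
  have hiff : ∀ x y : H, x⁻¹ * y ∈ crossedHomKer χ D hD ↔ D x = D y := by
    intro x y
    have hχ : χ x⁻¹ ≠ 0 := fun h => by
      have := χ.map_one
      rw [← inv_mul_cancel x, map_mul, h, zero_mul] at this
      exact zero_ne_one this
    rw [mem_crossedHomKer, hD, crossedHom_inv hD, neg_add_eq_sub, ← mul_sub, mul_eq_zero,
      or_iff_right hχ, sub_eq_zero, eq_comm]
  refine Nat.card_eq_of_bijective (Quotient.lift D fun x y h =>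
    (hiff x y).1 (QuotientGroup.leftRel_apply.1 h)) ⟨?_, ?_⟩
  · intro x y
    induction x using Quotient.inductionOn
    induction y using Quotient.inductionOn
    intro h
    exact Quotient.sound (QuotientGroup.leftRel_apply.2 ((hiff _ _).2 h))
  · intro y
    obtain ⟨x, rfl⟩ := hsurj y
    exact ⟨Quotient.mk _ x, rfl⟩

/-- The kernel of a crossed homomorphism to a simple module is maximal, if the crossed
homomorphism is already surjective on a normal subgroup `P` acting trivially. -/
theorem isCoatom_crossedHomKer {χ : H →* K} {D : H → K}
    (hD : ∀ x y, D (x * y) = D x + χ x * D y) (P : Subgroup H) [P.Normal]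
    (hP : ∀ x ∈ P, χ x = 1) (hsurj : ∀ y, ∃ x ∈ P, D x = y)
    (hsimple : ∀ E : AddSubgroup K, (∀ h : H, ∀ y ∈ E, χ h * y ∈ E) →
      ∀ y ∈ E, y ≠ 0 → ∀ w, w ∈ E) :
    IsCoatom (crossedHomKer χ D hD) := by
  have hsplit : ∀ x, ∀ p ∈ P, D p = D x → p⁻¹ * x ∈ crossedHomKer χ D hD := by
    intro x p hp hpx
    rw [mem_crossedHomKer, hD, crossedHom_inv hD, hP _ (inv_mem hp), hpx, one_mul,
      neg_add_cancel]
  have hdec : ∀ x : H, ∃ p ∈ P, D p = D x ∧ p⁻¹ * x ∈ crossedHomKer χ D hD := fun x =>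
    (hsurj (D x)).imp fun p hp => ⟨hp.1, hp.2, hsplit x p hp.1 hp.2⟩
  constructor
  · intro h
    obtain ⟨x, -, hx⟩ := hsurj 1
    have : x ∈ crossedHomKer χ D hD := h ▸ Subgroup.mem_top x
    rw [mem_crossedHomKer, hx] at this
    exact one_ne_zero this
  · intro J hJ
    -- The values of `D` on `J ∩ P` form a nonzero submodule.
    let E : AddSubgroup K :=
      { carrier := {y | ∃ x ∈ J, x ∈ P ∧ D x = y}
        zero_mem' := ⟨1, one_mem _, one_mem _, crossedHom_one hD⟩
        add_mem' := by
          rintro _ _ ⟨x, hx, hxP, rfl⟩ ⟨y, hy, hyP, rfl⟩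
          exact ⟨x * y, mul_mem hx hy, mul_mem hxP hyP, by rw [hD, hP x hxP, one_mul]⟩
        neg_mem' := by
          rintro _ ⟨x, hx, hxP, rfl⟩
          exact ⟨x⁻¹, inv_mem hx, inv_mem hxP, by
            rw [crossedHom_inv hD, hP _ (inv_mem hxP), one_mul]⟩ }
    have hE : ∀ h : H, ∀ y ∈ E, χ h * y ∈ E := by
      rintro h _ ⟨x, hx, hxP, rfl⟩
      obtain ⟨p, hp, -, hm⟩ := hdec h
      have hmJ := hJ.le hm
      refine ⟨(p⁻¹ * h) * x * (p⁻¹ * h)⁻¹, mul_mem (mul_mem hmJ hx) (inv_mem hmJ),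
        Subgroup.Normal.conj_mem inferInstance x hxP _, ?_⟩
      have h0 : D (p⁻¹ * h) = 0 := hm
      have h1 : D (p⁻¹ * h)⁻¹ = 0 := (crossedHomKer χ D hD).inv_mem hm
      rw [hD, h1, mul_zero, add_zero, hD, h0, zero_add, map_mul, hP _ (inv_mem hp), one_mul]
    obtain ⟨x, hxJ, hx⟩ := SetLike.exists_of_lt hJ
    obtain ⟨p, hp, hpx, hm⟩ := hdec x
    have hpJ : p ∈ J := by
      have := mul_mem hxJ (inv_mem (hJ.le hm))
      rwa [mul_inv_rev, inv_inv, mul_inv_cancel_left] at this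
    have hall := hsimple E hE (D p) ⟨p, hpJ, hp, rfl⟩ (hpx ▸ hx)
    rw [eq_top_iff]
    intro y _
    obtain ⟨q, hqJ, hqP, hq⟩ := hall (D y)
    have := mul_mem hqJ (hJ.le (hsplit y q hqP hq))
    rwa [mul_inv_cancel_left] at this

theorem card_le_maxSubgroupCount {ι : Type*} [Finite ι] {n : ℕ} (F : ι → Subgroup H)
    (hF : Function.Injective F) (h : ∀ i, IsCoatom (F i) ∧ (F i).index = n) :
    ((Nat.card ι : ℕ) : ℕ∞) ≤ maxSubgroupCount H n := by
  have h1 : Set.range F ⊆ {M : Subgroup H | IsCoatom M ∧ M.index = n} := by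
    rintro _ ⟨i, rfl⟩
    exact h i
  refine le_trans (le_of_eq ?_) (Set.encard_le_encard h1)
  rw [← Set.image_univ, hF.encard_image, Set.encard_univ, ENat.card_eq_coe_natCard]

/-- The crossed homomorphisms `D₀ + ∑ i, a i * D i`, for varying coefficients `a`, have different
kernels. -/
theorem pow_card_le_maxSubgroupCount [Finite K] {ι : Type*} [Fintype ι] (χ : H →* K)
    (P : Subgroup H) [P.Normal] (hP : ∀ x ∈ P, χ x = 1) (D₀ : H → K)
    (hD₀ : ∀ x y, D₀ (x * y) = D₀ x + χ x * D₀ y) (D : ι → H → K)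
    (hD : ∀ i x y, D i (x * y) = D i x + χ x * D i y)
    (hsurj : ∀ y, ∃ x ∈ P, D₀ x = y ∧ ∀ i, D i x = 0)
    (hindep : ∀ (i : ι) (c : K), ∃ (x : H) (b : K), b ≠ 0 ∧ D₀ x = c * b ∧ D i x = b ∧
      ∀ j, j ≠ i → D j x = 0)
    (hsimple : ∀ E : AddSubgroup K, (∀ h : H, ∀ y ∈ E, χ h * y ∈ E) →
      ∀ y ∈ E, y ≠ 0 → ∀ w, w ∈ E) :
    ((Nat.card K ^ Fintype.card ι : ℕ) : ℕ∞) ≤ maxSubgroupCount H (Nat.card K) := by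
  classical
  let Δ : (ι → K) → H → K := fun a x => D₀ x + ∑ i, a i * D i x
  have hΔ : ∀ a x y, Δ a (x * y) = Δ a x + χ x * Δ a y := by
    intro a x y
    simp only [Δ, hD₀, hD, mul_add, Finset.sum_add_distrib, Finset.mul_sum]
    rw [add_add_add_comm]
    congr 2
    exact Finset.sum_congr rfl fun i _ => mul_left_comm _ _ _
  have hΔsurj : ∀ a y, ∃ x ∈ P, Δ a x = y := by
    intro a y
    obtain ⟨x, hx, hxy, h0⟩ := hsurj y
    exact ⟨x, hx, by simp [Δ, h0, hxy]⟩
  have := card_le_maxSubgroupCount (n := Nat.card K) (fun a => crossedHomKer χ (Δ a) (hΔ a)) ?_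
    fun a => ⟨isCoatom_crossedHomKer (hΔ a) P hP (hΔsurj a) hsimple,
      index_crossedHomKer (hΔ a) fun y => (hΔsurj a y).imp fun _ h => h.2⟩
  · rwa [Nat.card_fun, Nat.card_eq_fintype_card (α := ι)] at this
  · intro a a' h
    funext i
    obtain ⟨x, b, hb, hx₀, hxi, hxj⟩ := hindep i (-a i)
    have hval : ∀ a' : ι → K, Δ a' x = (a' i - a i) * b := by
      intro a'
      simp only [Δ]
      rw [hx₀, Finset.sum_eq_single i (fun j _ hj => by rw [hxj j hj, mul_zero])
        (fun h => absurd (Finset.mem_univ i) h), hxi]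
      ring
    have h1 : x ∈ crossedHomKer χ (Δ a) (hΔ a) := by
      rw [mem_crossedHomKer, hval, sub_self, zero_mul]
    have h2 : x ∈ crossedHomKer χ (Δ a') (hΔ a') := by
      have h' : crossedHomKer χ (Δ a) (hΔ a) = crossedHomKer χ (Δ a') (hΔ a') := h
      rwa [← h']
    rw [mem_crossedHomKer, hval] at h2
    exact (sub_eq_zero.1 ((mul_eq_zero.1 h2).resolve_right hb)).symm

end CrossedHom

theorem maxSubgroupCount_le_of_mulEquiv {G H : Type*} [Group G] [Group H] (e : G ≃* H) (n : ℕ) :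
    maxSubgroupCount H n ≤ maxSubgroupCount G n := by
  refine Set.encard_le_encard_of_injOn (f := fun M => M.comap (e : G →* H)) ?_
    (Subgroup.comap_injective e.surjective).injOn
  rintro M ⟨hM, hn⟩
  exact ⟨(Subgroup.isCoatom_comap e).2 hM,
    (Subgroup.index_comap_of_surjective M e.surjective).trans hn⟩

/-! ### Maximal subgroups of a split extension -/

section Split

variable {G : Type*} [Group G] (N : Subgroup G) [N.Normal] [IsMulCommutative N]
  [IsMulCommutative (G ⧸ N)] {k : ℕ} (g : Fin k → G ⧸ N)

/-- The group `G ⧸ N` acts trivially on `N / I N`. -/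
theorem coinvariants_mk_conjAct (hg : Subgroup.closure (Set.range g) = ⊤) (q : G ⧸ N) (n : N) :
    (Submodule.Quotient.mk (PolyModule.of N g (conjAct N q n)) : PolyModule.Coinvariants N g) =
      Submodule.Quotient.mk (PolyModule.of N g n) := by
  have hq : q ∈ Subgroup.closure (Set.range g) := hg ▸ Subgroup.mem_top q
  induction hq using Subgroup.closure_induction generalizing n with
  | mem x hx =>
    obtain ⟨i, rfl⟩ := hx
    obtain ⟨a, ha⟩ := QuotientGroup.mk_surjective (g i)
    have h1 : PolyModule.of N g (conjAct N (g i) n) =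
        (MvPolynomial.X i : MvPolynomial (Fin k) ℤ) • PolyModule.of N g n := by
      rw [PolyModule.X_smul N g i a ha.symm, ← ha]
      rfl
    rw [Submodule.Quotient.eq, h1]
    have h2 := Submodule.smul_mem_smul
      (Ideal.subset_span ⟨i, rfl⟩ : (MvPolynomial.X i - 1 : MvPolynomial (Fin k) ℤ) ∈ augIdeal k)
      (Submodule.mem_top (R := MvPolynomial (Fin k) ℤ) (x := PolyModule.of N g n))
    rwa [sub_smul, one_smul] at h2
  | one => rw [map_one, MulAut.one_apply]
  | mul x y _ _ hx hy => rw [map_mul, MulAut.mul_apply, hx, hy]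
  | inv x _ hx =>
    rw [← hx, ← MulAut.mul_apply, ← map_mul, mul_inv_cancel, map_one, MulAut.one_apply]

/-- The maximal subgroups of index `p` of `N ⋊ G ⧸ N` which arise from homomorphisms to
`ℤ ^ (ℓ + t)`, reduced modulo `p`. -/
theorem pow_le_maxSubgroupCount_of_prime [Group.FG N] (hg : Subgroup.closure (Set.range g) = ⊤)
    (hℓ : 1 ≤ torsionFreeRank (Additive (G ⧸ N))) (p : ℕ) [Fact p.Prime] :
    ((p ^ (torsionFreeRank (Additive (G ⧸ N)) - 1 +
      torsionFreeRank (PolyModule.Coinvariants N g)) : ℕ) : ℕ∞) ≤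
      maxSubgroupCount (N ⋊[conjAct N] (G ⧸ N)) p := by
  classical
  have hQ := module_finite_additive_quotient N g hg
  have hC : Module.Finite ℤ (PolyModule.Coinvariants N g) :=
    PolyModule.module_finite_int_quotient N g _
  obtain ⟨ℓ, hℓ'⟩ := Nat.exists_eq_add_of_le' hℓ
  rw [hℓ', Nat.add_sub_cancel]
  obtain ⟨f, hf, -⟩ := exists_surjective_to_int_pow (A := Additive (G ⧸ N)) hℓ'
  obtain ⟨f', hf', -⟩ := exists_surjective_to_int_pow (A := PolyModule.Coinvariants N g) rfl
  set t := torsionFreeRank (PolyModule.Coinvariants N g)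
  let F : N ⋊[conjAct N] (G ⧸ N) → Fin (ℓ + 1) → ℤ := fun x => f (Additive.ofMul x.right)
  let F' : N ⋊[conjAct N] (G ⧸ N) → Fin t → ℤ := fun x =>
    f' (Submodule.Quotient.mk (PolyModule.of N g x.left))
  have hF : ∀ x y, F (x * y) = F x + F y := fun x y => map_add f _ _
  have hF' : ∀ x y, F' (x * y) = F' x + F' y := by
    intro x y
    change f' (Submodule.Quotient.mk (PolyModule.of N g x.left +
      PolyModule.of N g (conjAct N x.right y.left))) = _
    rw [Submodule.Quotient.mk_add, map_add, coinvariants_mk_conjAct N g hg]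
    rfl
  have hsurj : ∀ (a : Fin (ℓ + 1) → ℤ) (b : Fin t → ℤ), ∃ x, F x = a ∧ F' x = b := by
    intro a b
    obtain ⟨q, hq⟩ := hf a
    obtain ⟨c, hc⟩ := hf' b
    obtain ⟨c, rfl⟩ := Submodule.mkQ_surjective _ c
    obtain ⟨n, rfl⟩ := PolyModule.of_surjective g c
    exact ⟨⟨n, Additive.toMul q⟩, hq, hc⟩
  have key := pow_card_le_maxSubgroupCount (H := N ⋊[conjAct N] (G ⧸ N)) (K := ZMod p)
    (ι := Fin ℓ ⊕ Fin t) 1 ⊤ (fun _ _ => rfl) (fun x => (F x 0 : ZMod p))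
    (fun x y => by rw [hF, MonoidHom.one_apply, one_mul, Pi.add_apply, Int.cast_add])
    (Sum.elim (fun i x => (F x i.succ : ZMod p)) (fun j x => (F' x j : ZMod p)))
    ?_ ?_ ?_ ?_
  · simpa using key
  · rintro (i | j) x y
    · simp [hF]
    · simp [hF']
  · intro y
    obtain ⟨y, rfl⟩ := ZMod.intCast_surjective y
    obtain ⟨x, hx, hx'⟩ := hsurj (Pi.single 0 y) 0
    refine ⟨x, Subgroup.mem_top x, by simp [hx], ?_⟩
    rintro (i | j)
    · simp [hx]
    · simp [hx']
  · intro i c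
    obtain ⟨c, rfl⟩ := ZMod.intCast_surjective c
    rcases i with i | j
    · obtain ⟨x, hx, hx'⟩ := hsurj (Pi.single 0 c + Pi.single i.succ 1) 0
      refine ⟨x, 1, one_ne_zero, by simp [hx, (Fin.succ_ne_zero i).symm], by simp [hx], ?_⟩
      rintro (i' | j) hne
      · have : i' ≠ i := fun h => hne (h ▸ rfl)
        simp [hx, this]
      · simp [hx']
    · obtain ⟨x, hx, hx'⟩ := hsurj (Pi.single 0 c) (Pi.single j 1)
      refine ⟨x, 1, one_ne_zero, by simp [hx], by simp [hx'], ?_⟩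
      rintro (i | j') hne
      · simp [hx]
      · have : j' ≠ j := fun h => hne (h ▸ rfl)
        simp [hx', this]
  · intro E _ y hy hy0 w
    obtain ⟨c, hc⟩ := ZMod.intCast_surjective (w * y⁻¹)
    have := zsmul_mem hy c
    rwa [zsmul_eq_mul, hc, inv_mul_cancel_right₀ hy0] at this

omit [IsMulCommutative N] in
/-- If `ℓ ≥ 1`, then every character `χ` of `G ⧸ N` admits a nonzero crossed homomorphism: either
`χ - 1`, or a homomorphism to `ℤ` if `χ` is trivial. -/
theorem exists_crossedHom_ne_zero (hg : Subgroup.closure (Set.range g) = ⊤)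
    (hℓ : 1 ≤ torsionFreeRank (Additive (G ⧸ N))) {K : Type*} [CommRing K] [IsDomain K] (χ : G ⧸ N →* K) :
    ∃ δ : G ⧸ N → K, (∀ x y, δ (x * y) = δ x + χ x * δ y) ∧ ∃ q, δ q ≠ 0 := by
  by_cases h : ∃ q, χ q ≠ 1
  · obtain ⟨q, hq⟩ := h
    exact ⟨fun x => χ x - 1, fun x y => by simp only [map_mul]; ring, q, sub_ne_zero.2 hq⟩
  · push Not at h
    have hQ := module_finite_additive_quotient N g hg
    obtain ⟨ℓ, hℓ'⟩ := Nat.exists_eq_add_of_le' hℓ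
    obtain ⟨f, hf, -⟩ := exists_surjective_to_int_pow (A := Additive (G ⧸ N)) hℓ'
    obtain ⟨q, hq⟩ := hf 1
    refine ⟨fun x => (f (Additive.ofMul x) 0 : K), fun x y => ?_, Additive.toMul q, ?_⟩
    · beta_reduce
      have hadd : f (Additive.ofMul (x * y)) = f (Additive.ofMul x) + f (Additive.ofMul y) :=
        map_add f _ _
      rw [h, one_mul, hadd, Pi.add_apply, Int.cast_add]
    · simp [hq]

/-- If the module `ℚ ⊗ N` needs `e + 1` generators, then the simple modules `R / m` with
`N → (R / m) ^ (e + 1)` surjective yield maximal subgroups of `N ⋊ G ⧸ N`. -/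
theorem exists_pow_le_maxSubgroupCount [Group.FG N] (hg : Subgroup.closure (Set.range g) = ⊤)
    (hℓ : 1 ≤ torsionFreeRank (Additive (G ⧸ N))) {e : ℕ}
    (he : e < Submodule.spanFinrank
      (⊤ : Submodule (ℚ ⊗[ℤ] MvPolynomial (Fin k) ℤ) (RatPolyModule N g)))
    {p : ℕ} (hp : p.Prime) :
    ∃ n ≥ p, ((n ^ (e + 1) : ℕ) : ℕ∞) ≤ maxSubgroupCount (N ⋊[conjAct N] (G ⧸ N)) n := by
  classical
  have := PolyModule.module_finite_int N g
  obtain ⟨m, hm, hpm, φ, hφ⟩ := exists_surjective_to_quotient_pow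
    (R := MvPolynomial (Fin k) ℤ) (N := PolyModule N g) hp.two_le (e := e) (by
      rintro ⟨u, c, hc, hu⟩
      exact absurd (RatPolyModule.spanFinrank_le N g u hc hu) (not_le.2 he))
  let F := MvPolynomial (Fin k) ℤ ⧸ m
  let π : MvPolynomial (Fin k) ℤ →+* F := Ideal.Quotient.mk m
  have hsm : ∀ (r : MvPolynomial (Fin k) ℤ) (z : F), r • z = π r * z := fun r z => by
    rw [Algebra.smul_def]; rfl
  have hpF : ∀ z : F, p • z = 0 := by
    intro z
    rw [nsmul_eq_mul, ← map_natCast π, Ideal.Quotient.eq_zero_iff_mem.2 hpm, zero_mul]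
  have hfin : Finite F := by
    obtain ⟨r, v, hv⟩ := Module.Finite.exists_fin (R := ℤ) (M := PolyModule N g)
    let φ₀ : PolyModule N g →ₗ[ℤ] F := ((LinearMap.proj 0).comp φ).restrictScalars ℤ
    have hφ₀ : Function.Surjective φ₀ := fun y => by
      obtain ⟨x, hx⟩ := hφ (fun _ => y)
      exact ⟨x, congrFun hx 0⟩
    refine (card_le_pow_of_span_eq_top hp.pos hpF (φ₀ ∘ v) ?_).1
    rw [Set.range_comp, ← Submodule.map_span, hv, Submodule.map_top, LinearMap.range_eq_top.2 hφ₀]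
  have hple : p ≤ Nat.card F := by
    refine Nat.le_of_dvd Nat.card_pos ((Nat.Prime.dvd_iff_not_coprime hp).2 fun hco => ?_)
    have h1 : addOrderOf (1 : F) ∣ p := addOrderOf_dvd_of_nsmul_eq_zero (hpF 1)
    have h2 : addOrderOf (1 : F) ∣ Nat.card F := addOrderOf_dvd_natCard 1
    have h3 := Nat.dvd_gcd h1 h2
    rw [hco, Nat.dvd_one, AddMonoid.addOrderOf_eq_one_iff] at h3
    exact one_ne_zero h3
  refine ⟨Nat.card F, hple, ?_⟩
  -- The group `G ⧸ N` acts on `R / m` by a character.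
  choose ρ hρ using exists_smul_of_eq_conjAct N g hg
  have hact : ∀ (q : G ⧸ N) (n : N) (i : Fin (e + 1)),
      φ (PolyModule.of N g (conjAct N q n)) i = π (ρ q) * φ (PolyModule.of N g n) i := by
    intro q n i
    rw [← hρ, map_smul, Pi.smul_apply, hsm]
  obtain ⟨n₁, hn₁⟩ : ∃ n₁ : N, φ (PolyModule.of N g n₁) 0 = 1 := by
    obtain ⟨x, hx⟩ := hφ 1
    obtain ⟨n, rfl⟩ := PolyModule.of_surjective g x
    exact ⟨n, congrFun hx 0⟩
  have hχ : ∀ q, π (ρ q) = φ (PolyModule.of N g (conjAct N q n₁)) 0 := fun q => by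
    rw [hact, hn₁, mul_one]
  let χ₀ : G ⧸ N →* F :=
    { toFun := fun q => π (ρ q)
      map_one' := by rw [hχ, map_one, MulAut.one_apply, hn₁]
      map_mul' := fun x y => by rw [hχ, map_mul, MulAut.mul_apply, hact, ← hχ] }
  have hχX : ∀ i, χ₀ (g i) = π (MvPolynomial.X i) := by
    intro i
    obtain ⟨a, ha⟩ := QuotientGroup.mk_surjective (g i)
    have h1 : PolyModule.of N g (conjAct N (g i) n₁) =
        (MvPolynomial.X i : MvPolynomial (Fin k) ℤ) • PolyModule.of N g n₁ := by
      rw [PolyModule.X_smul N g i a ha.symm, ← ha]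
      rfl
    change π (ρ (g i)) = _
    rw [hχ, h1, map_smul, Pi.smul_apply, hn₁, hsm, mul_one]
  obtain ⟨δ, hδ, q, hq⟩ := exists_crossedHom_ne_zero N g hg hℓ (K := F) χ₀
  let D : Fin (e + 1) → N ⋊[conjAct N] (G ⧸ N) → F := fun i x => φ (PolyModule.of N g x.left) i
  have hD : ∀ i x y, D i (x * y) = D i x + χ₀ x.right * D i y := by
    intro i x y
    change φ (PolyModule.of N g x.left + PolyModule.of N g (conjAct N x.right y.left)) i = _
    rw [map_add, Pi.add_apply, hact]
    rfl
  have hDsurj : ∀ (q : G ⧸ N) (a : Fin (e + 1) → F),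
      ∃ x : N ⋊[conjAct N] (G ⧸ N), x.right = q ∧ ∀ i, D i x = a i := by
    intro q a
    obtain ⟨x, hx⟩ := hφ a
    obtain ⟨n, rfl⟩ := PolyModule.of_surjective g x
    exact ⟨⟨n, q⟩, rfl, fun i => congrFun hx i⟩
  have key := pow_card_le_maxSubgroupCount (H := N ⋊[conjAct N] (G ⧸ N)) (K := F)
    (ι := Option (Fin e)) (χ₀.comp SemidirectProduct.rightHom) SemidirectProduct.rightHom.ker
    (fun x hx => by rw [MonoidHom.comp_apply, MonoidHom.mem_ker.1 hx, map_one])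
    (D 0) (hD 0) (fun j x => j.elim (δ x.right) (fun i => D i.succ x)) ?_ ?_ ?_ ?_
  · simpa using key
  · rintro (_ | i) x y
    · exact hδ _ _
    · exact hD _ _ _
  · intro y
    obtain ⟨x, hx1, hx⟩ := hDsurj 1 (Pi.single 0 y)
    refine ⟨x, hx1, by simp [hx], ?_⟩
    rintro (_ | i)
    · simp [hx1, crossedHom_one hδ]
    · simp [hx]
  · rintro (_ | i) c
    · obtain ⟨x, hxq, hx⟩ := hDsurj q (Pi.single 0 (c * δ q))
      refine ⟨x, δ q, hq, by simp [hx], by simp [hxq], ?_⟩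
      rintro (_ | i) hne
      · exact absurd rfl hne
      · simp [hx]
    · obtain ⟨x, hx1, hx⟩ := hDsurj 1 (Pi.single 0 c + Pi.single i.succ 1)
      refine ⟨x, 1, one_ne_zero, by simp [hx, (Fin.succ_ne_zero i).symm], by simp [hx], ?_⟩
      rintro (_ | i') hne
      · simp [hx1, crossedHom_one hδ]
      · have : i' ≠ i := fun h => hne (h ▸ rfl)
        simp [hx, this]
  · intro E hE y hy hy0 w
    obtain ⟨z, hz⟩ := Ideal.Quotient.exists_inv (I := m) hy0
    obtain ⟨r, hr⟩ := Ideal.Quotient.mk_surjective (w * z)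
    have h1 := MvPolynomial.smul_mem_of_forall_X_smul_mem E (fun i x hx => by
      rw [hsm, ← hχX]
      exact hE ⟨1, g i⟩ x hx) r hy
    rwa [hsm, show π r = w * z from hr, mul_assoc, mul_comm z, hz, mul_one] at h1

end Split

/-! ### The degree of maximal subgroup growth -/

section Degree

variable {G : Type*} [Group G]

theorem natCast_rpow_ennreal {n : ℕ} (hn : 0 < n) (α : ℝ) :
    (n : ENNReal) ^ α = ENNReal.ofReal ((n : ℝ) ^ α) := by
  rw [← ENNReal.ofReal_rpow_of_pos (by exact_mod_cast hn), ENNReal.ofReal_natCast]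

theorem mdeg_le_of_le_const_mul_rpow {E C : ℝ} {n₀ : ℕ}
    (h : ∀ n ≥ n₀, ∃ c : ℕ, maxSubgroupCount G n = c ∧ (c : ℝ) ≤ C * (n : ℝ) ^ E) :
    mdeg G ≤ (E : EReal) := by
  rw [← EReal.le_of_forall_lt_iff_le]
  intro α hα
  have hα' : 0 < α - E := sub_pos.2 (EReal.coe_lt_coe_iff.1 hα)
  refine sInf_le ⟨α, ?_, rfl⟩
  have hlim := ((tendsto_rpow_atTop hα').comp tendsto_natCast_atTop_atTop).eventually_ge_atTop C
  filter_upwards [hlim, Filter.eventually_ge_atTop n₀, Filter.eventually_gt_atTop 0]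
    with n hn hn₀ hpos
  obtain ⟨c, hc, hcle⟩ := h n hn₀
  have hpos' : (0 : ℝ) < n := by exact_mod_cast hpos
  have hle : (c : ℝ) ≤ (n : ℝ) ^ α := calc
    (c : ℝ) ≤ C * (n : ℝ) ^ E := hcle
    _ ≤ (n : ℝ) ^ (α - E) * (n : ℝ) ^ E :=
      mul_le_mul_of_nonneg_right hn (Real.rpow_nonneg hpos'.le _)
    _ = (n : ℝ) ^ α := by rw [← Real.rpow_add hpos', sub_add_cancel]
  rw [hc, natCast_rpow_ennreal hpos, ENat.toENNReal_coe, ← ENNReal.ofReal_natCast]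
  exact ENNReal.ofReal_le_ofReal hle

theorem le_mdeg_of_frequently {e : ℕ}
    (h : ∀ n₀ : ℕ, ∃ n ≥ n₀, ((n ^ e : ℕ) : ℕ∞) ≤ maxSubgroupCount G n) :
    ((e : ℝ) : EReal) ≤ mdeg G := by
  refine le_sInf ?_
  rintro _ ⟨α, hα, rfl⟩
  obtain ⟨n₀, hn₀⟩ := Filter.eventually_atTop.1 hα
  obtain ⟨n, hn, hle⟩ := h (n₀ + 2)
  have hpos : 0 < n := by omega
  have h1 : (((n ^ e : ℕ) : ℕ∞) : ENNReal) ≤ (n : ENNReal) ^ α :=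
    (ENat.toENNReal_le.2 hle).trans (hn₀ n (by omega))
  rw [natCast_rpow_ennreal hpos, ENat.toENNReal_coe, ← ENNReal.ofReal_natCast,
    ENNReal.ofReal_le_ofReal_iff (Real.rpow_nonneg (Nat.cast_nonneg n) _), Nat.cast_pow,
    ← Real.rpow_natCast, Real.rpow_le_rpow_left_iff (by exact_mod_cast (by omega : 1 < n))] at h1
  exact EReal.coe_le_coe_iff.2 h1

end Degree

theorem mainTheorem1 {G : Type*} [Group G] (N : Subgroup G) [N.Normal]
    [IsMulCommutative N] [Group.FG N] [IsMulCommutative (G ⧸ N)]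
    (ℓ₀ : ℕ) (g : Fin ℓ₀ → G ⧸ N) (hg : Subgroup.closure (Set.range g) = ⊤)
    (ℓ t d : ℕ)
    (hℓ : ℓ = torsionFreeRank (Additive (G ⧸ N)))
    (ht : t = torsionFreeRank (PolyModule.Coinvariants N g))
    (hd : d = Submodule.spanFinrank
      (⊤ : Submodule (ℚ ⊗[ℤ] MvPolynomial (Fin ℓ₀) ℤ) (RatPolyModule N g))) :
    mdeg G ≤ ((max ((ℓ : ℝ) + t - 1) d : ℝ) : EReal) ∧
      (Nonempty (G ≃* N ⋊[conjAct N] (G ⧸ N)) → 1 ≤ ℓ →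
        mdeg G = ((max ((ℓ : ℝ) + t - 1) d : ℝ) : EReal)) := by
  have hupper : mdeg G ≤ ((max ((ℓ : ℝ) + t - 1) d : ℝ) : EReal) := by
    obtain ⟨C₁, n₁, h₁⟩ := exists_ncard_normal_mul_le N g hg
    obtain ⟨C₂, n₂, h₂⟩ := exists_ncard_not_normal_le N g hg
    rw [← hℓ, ← ht] at h₁
    rw [← hd] at h₂
    refine mdeg_le_of_le_const_mul_rpow (C := C₁ + C₂) (n₀ := n₁ + n₂ + 1) fun n hn => ?_
    obtain ⟨hfin₁, hcard₁⟩ := h₁ n (by omega)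
    obtain ⟨hfin₂, hcard₂⟩ := h₂ n (by omega)
    set S₁ := {M : Subgroup G | IsCoatom M ∧ M.index = n ∧ M.Normal}
    set S₂ := {M : Subgroup G | IsCoatom M ∧ M.index = n ∧ ¬ M.Normal}
    have hunion : {M : Subgroup G | IsCoatom M ∧ M.index = n} = S₁ ∪ S₂ := by
      ext M
      by_cases hM : M.Normal <;> simp [S₁, S₂, hM]
    refine ⟨(S₁ ∪ S₂).ncard, ?_, ?_⟩
    · rw [maxSubgroupCount, hunion, (hfin₁.union hfin₂).cast_ncard_eq]
    have hn1 : (1 : ℝ) ≤ n := by exact_mod_cast (by omega : 1 ≤ n)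
    have hpos : (0 : ℝ) < n := by linarith
    have hS₁ : (S₁.ncard : ℝ) ≤ C₁ * (n : ℝ) ^ max ((ℓ : ℝ) + t - 1) (d : ℝ) := by
      have h1 : (S₁.ncard : ℝ) * n ≤ C₁ * (n : ℝ) ^ (ℓ + t) := by exact_mod_cast hcard₁
      have h2 : (n : ℝ) ^ (ℓ + t) = (n : ℝ) ^ ((ℓ : ℝ) + t - 1) * n := by
        rw [← Real.rpow_add_one hpos.ne', sub_add_cancel, ← Nat.cast_add, Real.rpow_natCast]
      rw [h2, ← mul_assoc] at h1
      refine (le_of_mul_le_mul_right h1 hpos).trans ?_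
      exact mul_le_mul_of_nonneg_left (Real.rpow_le_rpow_of_exponent_le hn1 (le_max_left _ _))
        (Nat.cast_nonneg _)
    have hS₂ : (S₂.ncard : ℝ) ≤ C₂ * (n : ℝ) ^ max ((ℓ : ℝ) + t - 1) (d : ℝ) := by
      have h1 : (S₂.ncard : ℝ) ≤ C₂ * (n : ℝ) ^ d := by exact_mod_cast hcard₂
      refine h1.trans (mul_le_mul_of_nonneg_left ?_ (Nat.cast_nonneg _))
      rw [← Real.rpow_natCast]
      exact Real.rpow_le_rpow_of_exponent_le hn1 (le_max_right _ _)
    calc ((S₁ ∪ S₂).ncard : ℝ) ≤ S₁.ncard + S₂.ncard := by exact_mod_cast Set.ncard_union_le _ _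
      _ ≤ _ := by rw [add_mul]; exact add_le_add hS₁ hS₂
  refine ⟨hupper, fun ⟨e⟩ hℓ1 => le_antisymm hupper ?_⟩
  have hmax : ∀ a b : ℝ, (a : EReal) ≤ mdeg G → (b : EReal) ≤ mdeg G →
      ((max a b : ℝ) : EReal) ≤ mdeg G := fun a b ha hb => by
    rcases max_choice a b with h | h <;> rwa [h]
  refine hmax _ _ ?_ ?_
  · have h := le_mdeg_of_frequently (G := G) (e := ℓ - 1 + t) fun n₀ => by
      obtain ⟨p, hp, hprime⟩ := Nat.exists_infinite_primes n₀
      have := Fact.mk hprime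
      have h := pow_le_maxSubgroupCount_of_prime N g hg (hℓ ▸ hℓ1) p
      rw [← hℓ, ← ht] at h
      exact ⟨p, hp, h.trans (maxSubgroupCount_le_of_mulEquiv e p)⟩
    rw [Nat.cast_add, Nat.cast_sub hℓ1, Nat.cast_one, sub_add_eq_add_sub] at h
    exact h
  · refine le_mdeg_of_frequently fun n₀ => ?_
    obtain ⟨p, hp, hprime⟩ := Nat.exists_infinite_primes n₀
    rcases Nat.eq_zero_or_pos d with hd0 | hd0
    · -- There is some maximal subgroup of index `p`, as `ℓ ≥ 1`.
      have := Fact.mk hprime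
      have h := pow_le_maxSubgroupCount_of_prime N g hg (hℓ ▸ hℓ1) p
      refine ⟨p, hp, le_trans ?_ (h.trans (maxSubgroupCount_le_of_mulEquiv e p))⟩
      rw [hd0, pow_zero]
      exact_mod_cast Nat.one_le_pow _ _ hprime.pos
    · obtain ⟨n, hn, h⟩ := exists_pow_le_maxSubgroupCount N g hg (hℓ ▸ hℓ1) (e := d - 1)
        (by omega) hprime
      rw [Nat.sub_add_cancel hd0] at h
      exact ⟨n, hp.trans hn, h.trans (maxSubgroupCount_le_of_mulEquiv e n)⟩
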